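/- Let $n\ge 1$, let $\mathbf R^{1+n}_+=\{(t,x): t>0,\ x\in\mathbf R^n\}$ with Lebesgue measure $dt\,dx$, and fix constants $a>0$, $c_0>1$, $c_1>0$. All functions $f,g$ below are measurable real-valued (or all are complex-valued) functions on $\mathbf R^{1+n}_+$, and all norms take values in $[0,\infty]$ (with $0\cdot\infty=0$). For $(t,x)\in\mathbf R^{1+n}_+$ put $$W(t,x)=\{(s,y)\in\mathbf R^{1+n}_+: |y-x|<c_1t,\ c_0^{-1}<s/t<c_0\},\qquad W_qf(t,x)=|W(t,x)|^{-1/q}\,\|f\|_{L_q(W(t,x))}\quad(1\le q\le\infty).$$ For $F\colon\mathbf R^{1+n}_+\to[0,\infty]$, $1\le r<\infty$ and $z\in\mathbf R^n$ put $$N_*F(z)=\sup_{t>0,\ |x-z|\le at}F(t,x),\qquad C^rF(z)=\sup_{Q\ni z}\Big(\frac1{|Q|}\iint_{\widehat Q}F(t,x)^r\,dt\,dx\Big)^{1/r},$$ where $Q$ ranges over the axis-parallel cubes of $\mathbf R^n$ containing $z$ and $\widehat Q=(0,\ell(Q))\times Q$, with $\ell(Q)$ the sidelength of $Q$. (1)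 Let $\frac1p+\frac1{\tilde p}=\frac1q+\frac1{\tilde q}=\frac1r$ with $r\le p<\infty$, $r\le q\le\infty$ and $1\le r<\infty$. Then there is a constant $0<C<\infty$, independent of $f$ and $g$, such that for all $f$ and $g$ $$\|fg\|_{L_r(\mathbf R^{1+n}_+)}\le C\,\|N_*(W_qf)\|_{L_p(\mathbf R^n)}\,\|C^r(W_{\tilde q}g)\|_{L_{\tilde p}(\mathbf R^n)},$$ $$\|N_*(W_qf)\|_{L_p(\mathbf R^n)}\le C\sup_{\|C^r(W_{\tilde q}g)\|_{L_{\tilde p}(\mathbf R^n)}=1}\|fg\|_{L_r(\mathbf R^{1+n}_+)},$$ $$\|C^r(W_{\tilde q}g)\|_{L_{\tilde p}(\mathbf R^n)}\le C\sup_{\|N_*(W_qf)\|_{L_p(\mathbf R^n)}=1}\|fg\|_{L_r(\mathbf R^{1+n}_+)}.$$ (2) In particular, let $\mathcal X$ be the space of $f$ with $\|f\|_{\mathcal X}=\|N_*(W_2f)\|_{L_2(\mathbf R^n)}<\infty$. There is a constant $0<C<\infty$ such that for all $g$ $$C^{-1}\sup_Q\Big(\frac1{|Q|}\iint_{\widehat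 Q}(W_\infty g)^2\,dt\,dx\Big)^{1/2}\le\sup_{0\ne f\in\mathcal X}\frac{\|gf\|_{L_2(\mathbf R^{1+n}_+)}}{\|f\|_{\mathcal X}}\le C\sup_Q\Big(\frac1{|Q|}\iint_{\widehat Q}(W_\infty g)^2\,dt\,dx\Big)^{1/2},$$ where $Q$ ranges over all axis-parallel cubes of $\mathbf R^n$. Hence $f\mapsto gf$ is a bounded map from $\mathcal X$ to $L_2(\mathbf R^{1+n}_+)$ if and only if $\sup_Q\frac1{|Q|}\iint_{\widehat Q}(W_\infty g)^2\,dt\,dx<\infty$. -/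

import Mathlib

open MeasureTheory Set
open scoped ENNReal NNReal

namespace CarlesonDuality

/-- The space `ℝ × ℝⁿ` of points `(t, x)`, with the Euclidean norm on the factor `ℝⁿ`. -/
abbrev Space (n : ℕ) : Type := ℝ × EuclideanSpace ℝ (Fin n)

/-- The open upper half space `{(t, x) : t > 0}`. Functions on it are represented by functions on
`Space n`, of which only the values at points with `t > 0` are ever used. -/
def halfSpace (n : ℕ) : Set (Space n) := {z | 0 < z.1}

/-- Lebesgue measure `dt dx` on the upper half space. -/
noncomputable def halfMeasure (n : ℕ) : Measure (Space n) := volume.restrict (halfSpace n)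

/-- The Whitney region around `z = (t, x)`: all `(s, y)` in the upper half space with
`|y - x| < c₁ t` and `c₀⁻¹ < s / t < c₀`. -/
def whitneyRegion {n : ℕ} (c₀ c₁ : ℝ) (z : Space n) : Set (Space n) :=
  {w | w ∈ halfSpace n ∧ ‖w.2 - z.2‖ < c₁ * z.1 ∧ c₀⁻¹ < w.1 / z.1 ∧ w.1 / z.1 < c₀}

/-- The Whitney average `|W(t,x)|^(-1/q) ‖f‖_{L_q(W(t,x))}`; for `q = ∞` the exponent is `0`. -/
noncomputable def whitneyAverage {𝕜 : Type*} [RCLike 𝕜] {n : ℕ} (c₀ c₁ : ℝ) (q : ℝ≥0∞)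
    (f : Space n → 𝕜) (z : Space n) : ℝ≥0∞ :=
  (volume (whitneyRegion c₀ c₁ z)) ^ (-(1 / q).toReal) *
    eLpNorm f q (volume.restrict (whitneyRegion c₀ c₁ z))

/-- The non-tangential maximal function of aperture `a`:
the supremum of `F(t, x)` over `t > 0`, `|x - y| ≤ a t`. -/
noncomputable def nontangentialMax {n : ℕ} (a : ℝ) (F : Space n → ℝ≥0∞)
    (y : EuclideanSpace ℝ (Fin n)) : ℝ≥0∞ :=
  ⨆ (z : Space n) (_ : z ∈ halfSpace n ∧ ‖z.2 - y‖ ≤ a * z.1), F z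

/-- The open axis-parallel cube in `ℝⁿ` with lower corner `b` and sidelength `ℓ`. -/
def cube {n : ℕ} (b : EuclideanSpace ℝ (Fin n)) (ℓ : ℝ) : Set (EuclideanSpace ℝ (Fin n)) :=
  {y | ∀ i, b i < y i ∧ y i < b i + ℓ}

/-- The Carleson box `(0, ℓ) × Q` over the cube `Q` with lower corner `b` and sidelength `ℓ`. -/
def carlesonBox {n : ℕ} (b : EuclideanSpace ℝ (Fin n)) (ℓ : ℝ) : Set (Space n) :=
  Ioo 0 ℓ ×ˢ cube b ℓ

/-- `((1 / |Q|) ∬_{Q̂} F ^ r dt dx) ^ (1 / r)` for the cube `Q` with corner `b` and sidelength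
`ℓ`. -/
noncomputable def boxMean {n : ℕ} (r : ℝ) (F : Space n → ℝ≥0∞)
    (b : EuclideanSpace ℝ (Fin n)) (ℓ : ℝ) : ℝ≥0∞ :=
  ((volume (cube b ℓ))⁻¹ * ∫⁻ z in carlesonBox b ℓ, F z ^ r) ^ (1 / r)

/-- The Carleson functional `C^r`: the supremum of the box means over all cubes containing `x`. -/
noncomputable def carlesonFunctional {n : ℕ} (r : ℝ) (F : Space n → ℝ≥0∞)
    (x : EuclideanSpace ℝ (Fin n)) : ℝ≥0∞ :=
  ⨆ (b : EuclideanSpace ℝ (Fin n)) (ℓ : ℝ) (_ : 0 < ℓ ∧ x ∈ cube b ℓ), boxMean r F b ℓ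

/-- `‖N_*(W_q f)‖_{L_p(ℝⁿ)}`. -/
noncomputable def nontangentialNorm {𝕜 : Type*} [RCLike 𝕜] {n : ℕ} (a c₀ c₁ : ℝ) (p q : ℝ≥0∞)
    (f : Space n → 𝕜) : ℝ≥0∞ :=
  eLpNorm (nontangentialMax a (whitneyAverage c₀ c₁ q f)) p volume

/-- `‖C^r(W_q g)‖_{L_p(ℝⁿ)}`. -/
noncomputable def carlesonNorm {𝕜 : Type*} [RCLike 𝕜] {n : ℕ} (c₀ c₁ : ℝ) (r : ℝ) (p q : ℝ≥0∞)
    (g : Space n → 𝕜) : ℝ≥0∞ :=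
  eLpNorm (carlesonFunctional r (whitneyAverage c₀ c₁ q g)) p volume

/-- `‖f g‖_{L_r}` over the upper half space. -/
noncomputable def productNorm {𝕜 : Type*} [RCLike 𝕜] {n : ℕ} (r : ℝ≥0∞)
    (f g : Space n → 𝕜) : ℝ≥0∞ :=
  eLpNorm (fun z => f z * g z) r (halfMeasure n)

/-- The Kenig--Pipher norm `‖f‖_𝒳 = ‖N_*(W_2 f)‖_{L_2(ℝⁿ)}`. -/
noncomputable def kenigPipherNorm {𝕜 : Type*} [RCLike 𝕜] {n : ℕ} (a c₀ c₁ : ℝ)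
    (f : Space n → 𝕜) : ℝ≥0∞ :=
  nontangentialNorm a c₀ c₁ 2 2 f

/-- Dahlberg's modified Carleson norm `sup_Q ((1 / |Q|) ∬_{Q̂} (W_∞ g)² dt dx) ^ (1 / 2)`. -/
noncomputable def dahlbergNorm {𝕜 : Type*} [RCLike 𝕜] {n : ℕ} (c₀ c₁ : ℝ)
    (g : Space n → 𝕜) : ℝ≥0∞ :=
  ⨆ (b : EuclideanSpace ℝ (Fin n)) (ℓ : ℝ) (_ : 0 < ℓ), boxMean 2 (whitneyAverage c₀ c₁ ∞ g) b ℓ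

/-- The multiplier norm `sup ‖g f‖_{L_2} / ‖f‖_𝒳` over all nonzero `f` in `𝒳`. -/
noncomputable def multiplierNorm {𝕜 : Type*} [RCLike 𝕜] {n : ℕ} (a c₀ c₁ : ℝ)
    (g : Space n → 𝕜) : ℝ≥0∞ :=
  ⨆ (f : Space n → 𝕜) (_ : AEStronglyMeasurable f (halfMeasure n) ∧
      kenigPipherNorm a c₀ c₁ f ≠ 0 ∧ kenigPipherNorm a c₀ c₁ f ≠ ∞),
    productNorm 2 f g / kenigPipherNorm a c₀ c₁ f

/-- `g` is a bounded multiplier from `𝒳` to `L_2`: multiplication by `g` maps `𝒳` to `L_2` of the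
upper half space, with operator norm at most some finite `K`. -/
def IsBoundedMultiplier {𝕜 : Type*} [RCLike 𝕜] {n : ℕ} (a c₀ c₁ : ℝ) (g : Space n → 𝕜) : Prop :=
  ∃ K : ℝ≥0, ∀ f : Space n → 𝕜, AEStronglyMeasurable f (halfMeasure n) →
    kenigPipherNorm a c₀ c₁ f ≠ ∞ →
      MemLp (fun z => f z * g z) 2 (halfMeasure n) ∧
        productNorm 2 f g ≤ K * kenigPipherNorm a c₀ c₁ f

end CarlesonDuality

/-!
Everything reduces to nonnegative functions and `r = 1`: with `u = |f|^r` and `v = |g|^r`, the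
`r`-th powers of the three norms are the corresponding quantities for `u`, `v` and the exponents
divided by `r`. Write `N` for the non-tangential maximal function, `C` for the Carleson functional
with `r = 1`, `A_q` for the Whitney average and `M` for the Hardy--Littlewood maximal function.

*Product estimate.* By Fubini the integral of `u v` is bounded by that of its Whitney averages, and
Hölder's inequality on each Whitney region bounds these by `A_q u · A_{q'} v`. Carleson's inequality
`∬ F G ≲ ∫ N F · C G` and Hölder's inequality on `ℝⁿ` finish the argument. Carleson's inequality
follows by integrating over the level sets of `F`: the shadow of a point with `F > t` lies in
`{N F > t}`, and a Vitali subfamily of these shadows is disjoint while the Carleson boxes over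
their dilates cover `{F > t}` (`exists_setLIntegral_le_carlesonFunctional`).

*Reverse estimates.* The common tool is `exists_superposition`: given points `z_k` and masses `m_k`,
the sum of near-extremal functions for `L_q`--`L_{q'}` duality on the regions `W(z_k)`, weighted by
`m_k`, pairs with `u` to about `∑ m_k A_q u(z_k)`, and its own Whitney averages are controlled by
the masses near the point.

For `‖N (A_q u)‖_p`, a dual function `h ∈ L_{p'}` on `ℝⁿ` is split among finitely many points at which
the supremum defining `N` is nearly attained. The Carleson functional of the superposition is at
most a multiple of `M h`, and `M` is bounded on `L_{p'}` because `p' > 1`.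

For `‖C (A_{q'} u)‖_{p'}` the half space is cut into disjoint cells inside Whitney regions, and the
masses are the integrals of a weight `H` over the cells (`exists_lintegral_mul_ge_weighted`). If
`p' = ∞`, the weight is the indicator of one Carleson box. If `p' < ∞`, then `C G ≲ M (A G)` for the
area functional `A`, so that it suffices to bound `‖A G‖_{p'}` by duality; the weight is then the
ball average `H(t, x)` of a dual function `h ∈ L_p`, whose non-tangential maximal function is
controlled by `M h`.

The statements about multipliers are the case `p = q = r = 2`, in which both conjugate exponents
are `∞`.
-/

namespace CarlesonDuality

open Filter Topology Metric

/-! ### Integrals of extended nonnegative functions -/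

section Integrals

variable {α : Type*} [MeasurableSpace α] {μ : Measure α}

/-- Fatou's lemma for a family of sets: if every point of `S x` stays in `S x'` for `x'` near `x`,
then `x ↦ ∫_{S x} u` is lower semicontinuous. -/
lemma lowerSemicontinuousAt_setLIntegral {X : Type*} [TopologicalSpace X]
    [FirstCountableTopology X] {S : X → Set α} (hS : ∀ x, MeasurableSet (S x)) {x : X}
    (hx : ∀ w ∈ S x, ∀ᶠ x' in 𝓝 x, w ∈ S x') {u : α → ℝ≥0∞} (hu : Measurable u) :
    LowerSemicontinuousAt (fun x => ∫⁻ w in S x, u w ∂μ) x := by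
  rw [lowerSemicontinuousAt_iff_le_liminf]
  simp_rw [← lintegral_indicator (hS _)]
  refine le_trans (lintegral_mono fun w => ?_)
    (lintegral_liminf_le (u := 𝓝 x) fun x' => hu.indicator (hS x'))
  by_cases hw : w ∈ S x
  · rw [indicator_of_mem hw]
    refine le_liminf_of_le (by isBoundedDefault) ?_
    filter_upwards [hx w hw] with x' hx'
    rw [indicator_of_mem hx']
  · simp [hw]

/-- Hölder's inequality for a pair of conjugate exponents in `[1, ∞]`. -/
lemma lintegral_mul_le_eLpNorm_mul {p q : ℝ≥0∞} [hpq : ENNReal.HolderConjugate p q]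
    {f g : α → ℝ≥0∞} (hf : AEMeasurable f μ) (hg : AEMeasurable g μ) :
    ∫⁻ x, f x * g x ∂μ ≤ eLpNorm f p μ * eLpNorm g q μ := by
  have key : ∀ {f g : α → ℝ≥0∞}, AEMeasurable f μ → AEMeasurable g μ →
      ∫⁻ x, f x * g x ∂μ ≤ eLpNorm f ∞ μ * eLpNorm g 1 μ := by
    intro f g hf hg
    rw [eLpNorm_one_eq_lintegral_enorm, eLpNorm_exponent_top, ← lintegral_const_mul'' _ hg.enorm]
    refine lintegral_mono_ae ?_
    filter_upwards [enorm_ae_le_eLpNormEssSup f μ] with x hx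
    simpa using mul_le_mul_left hx (g x)
  by_cases hp : p = ∞
  · have hq := (ENNReal.HolderConjugate.eq_top_iff_eq_one p q).1 hp
    subst hp hq
    exact key hf hg
  by_cases hq : q = ∞
  · have hp' := (ENNReal.HolderConjugate.eq_top_iff_eq_one q p).1 hq
    subst hp' hq
    rw [mul_comm]
    simp_rw [mul_comm (f _)]
    exact key hg hf
  have hp0 := ENNReal.HolderConjugate.ne_zero p q
  have hq0 := ENNReal.HolderConjugate.ne_zero q p
  rw [eLpNorm_eq_lintegral_rpow_enorm_toReal hp0 hp, eLpNorm_eq_lintegral_rpow_enorm_toReal hq0 hq]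
  have h := ENNReal.HolderTriple.toReal 1 (p := p) (q := q) (ENNReal.toReal_pos hp0 hp)
    (ENNReal.toReal_pos hq0 hq)
  rw [ENNReal.toReal_one] at h
  simpa using ENNReal.lintegral_mul_le_Lp_mul_Lq μ h hf hg

lemma eLpNorm_const_mul_le (p : ℝ≥0∞) (c : ℝ≥0) (f : α → ℝ≥0∞) :
    eLpNorm (fun x => c * f x) p μ ≤ c * eLpNorm f p μ :=
  eLpNorm_le_mul_eLpNorm_of_ae_le_mul' (by simp) p

/-- A lower bound for the norm of `L_p` by pairings: every number below `‖u‖_p` is exceeded by the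
integral of `u` against an integrable finite-valued function in the unit ball of `L_q`. -/
lemma exists_lt_lintegral_mul [SigmaFinite μ] {p q : ℝ≥0∞} [hpq : ENNReal.HolderConjugate p q]
    {u : α → ℝ≥0∞} (hu : Measurable u) {l : ℝ≥0∞} (hl : l < eLpNorm u p μ) :
    ∃ v : α → ℝ≥0, Measurable v ∧ eLpNorm (fun x => (v x : ℝ≥0∞)) q μ ≤ 1 ∧
      ∫⁻ x, v x ∂μ ≠ ∞ ∧ l < ∫⁻ x, u x * v x ∂μ := by
  have hS := measurableSet_spanningSets μ
  have hμS := measure_spanningSets_lt_top μ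
  by_cases hp : p = ∞
  · have hq := (ENNReal.HolderConjugate.eq_top_iff_eq_one p q).1 hp
    subst hp hq
    obtain ⟨l', hll', hl'⟩ := exists_between hl
    have hpos : μ {x | l' < u x} ≠ 0 := by
      intro h0
      refine hl'.not_ge ?_
      rw [eLpNorm_exponent_top]
      refine eLpNormEssSup_le_of_ae_enorm_bound ?_
      rw [ae_iff]
      simpa using h0
    obtain ⟨k, hk⟩ : ∃ k, μ ({x | l' < u x} ∩ spanningSets μ k) ≠ 0 := by
      by_contra! h
      refine hpos ?_
      rw [← inter_univ {x | l' < u x}, ← iUnion_spanningSets μ, inter_iUnion]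
      exact measure_iUnion_null h
    set A := {x | l' < u x} ∩ spanningSets μ k
    have hA : MeasurableSet A := (measurableSet_lt measurable_const hu).inter (hS k)
    have hAtop : μ A ≠ ∞ := measure_ne_top_of_subset inter_subset_right (hμS k).ne
    have hv : ∫⁻ x, ((A.indicator (fun _ => (μ A).toNNReal⁻¹) x : ℝ≥0) : ℝ≥0∞) ∂μ = 1 := by
      simp_rw [ENNReal.coe_indicator]
      rw [lintegral_indicator_const hA, ENNReal.coe_inv (by simp [ENNReal.toNNReal_eq_zero_iff, hk, hAtop]),
        ENNReal.coe_toNNReal hAtop, ENNReal.inv_mul_cancel hk hAtop]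
    refine ⟨A.indicator fun _ => (μ A).toNNReal⁻¹, measurable_const.indicator hA, ?_, ?_, ?_⟩
    · rw [eLpNorm_one_eq_lintegral_enorm]
      simpa using hv.le
    · exact hv.trans_ne ENNReal.one_ne_top
    · calc l < l' * 1 := by simpa using hll'
        _ = ∫⁻ x, l' * ((A.indicator (fun _ => (μ A).toNNReal⁻¹) x : ℝ≥0) : ℝ≥0∞) ∂μ := by
          rw [lintegral_const_mul _ (measurable_const.indicator hA).coe_nnreal_ennreal, hv]
        _ ≤ _ := by
          refine lintegral_mono fun x => ?_
          by_cases hx : x ∈ A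
          · exact mul_le_mul_left hx.1.le _
          · simp [hx]
  have hp0 := ENNReal.HolderConjugate.ne_zero p q
  have hp1 : 1 ≤ p.toReal := by
    simpa using ENNReal.toReal_mono hp (ENNReal.HolderConjugate.one_le p q)
  set s := p.toReal with hs
  have hs0 : 0 < s := by linarith
  -- truncations of `u` with finite norm
  let U : ℕ → α → ℝ≥0 := fun k => (spanningSets μ k).indicator fun x => (min (u x) k).toNNReal
  have hUm : ∀ k, Measurable (U k) := fun k =>
    ((hu.min measurable_const).ennreal_toNNReal).indicator (hS k)
  have hUe : ∀ k x, (U k x : ℝ≥0∞) = (spanningSets μ k).indicator (fun x => min (u x) k) x := by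
    intro k x
    simp only [U, ENNReal.coe_indicator]
    congr 1
    ext x
    exact ENNReal.coe_toNNReal (ne_top_of_le_ne_top (by simp) (min_le_right _ _))
  have hUle : ∀ k x, (U k x : ℝ≥0∞) ≤ u x := by
    intro k x
    rw [hUe]
    exact (indicator_le_self' (fun _ _ => zero_le) x).trans (min_le_left _ _)
  have hsup : ∀ x, ⨆ k, (U k x : ℝ≥0∞) ^ s = u x ^ s := by
    intro x
    apply le_antisymm
    · exact iSup_le fun k => ENNReal.rpow_le_rpow (hUle k x) hs0.le
    · refine le_of_forall_lt fun c hc => ?_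
      obtain ⟨j, hj⟩ : ∃ j, x ∈ spanningSets μ j := by
        exact mem_iUnion.1 ((iUnion_spanningSets μ).symm.subset (mem_univ x))
      obtain ⟨b, hb, hcb⟩ : ∃ b < u x, c < b ^ s := by
        have hc' : c ^ s⁻¹ < u x := by
          rwa [ENNReal.rpow_inv_lt_iff hs0]
        obtain ⟨b, hb1, hb2⟩ := exists_between hc'
        exact ⟨b, hb2, by rwa [ENNReal.rpow_inv_lt_iff hs0] at hb1⟩
      obtain ⟨m, hm⟩ := ENNReal.exists_nat_gt hb.ne_top
      refine lt_of_lt_of_le hcb (le_iSup_of_le (max j m) ?_)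
      rw [hUe, indicator_of_mem (monotone_spanningSets μ (le_max_left j m) hj)]
      refine ENNReal.rpow_le_rpow (le_min hb.le (hm.le.trans ?_)) hs0.le
      exact_mod_cast le_max_right j m
  have hmono : Monotone fun k x => (U k x : ℝ≥0∞) ^ s := by
    intro j k hjk x
    refine ENNReal.rpow_le_rpow ?_ hs0.le
    rw [hUe, hUe]
    refine (indicator_le_indicator_of_subset (monotone_spanningSets μ hjk) (fun _ => zero_le) x).trans
      (indicator_le_indicator ?_)
    gcongr
  rw [eLpNorm_eq_lintegral_rpow_enorm_toReal hp0 hp, ← hs] at hl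
  simp only [enorm_eq_self, ← hsup] at hl
  rw [lintegral_iSup (fun k => (hUm k).coe_nnreal_ennreal.pow_const s) hmono] at hl
  rw [one_div, ENNReal.lt_rpow_inv_iff hs0, lt_iSup_iff] at hl
  obtain ⟨k, hk⟩ := hl
  set J := ∫⁻ x, (U k x : ℝ≥0∞) ^ s ∂μ with hJ
  have hJtop : J ≠ ∞ := by
    refine ne_top_of_le_ne_top (b := ∫⁻ x in spanningSets μ k, (k : ℝ≥0∞) ^ s ∂μ) ?_ ?_
    · rw [setLIntegral_const]
      exact ENNReal.mul_ne_top (by simp [hs0.le]) (hμS k).ne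
    · rw [← lintegral_indicator (hS k)]
      refine lintegral_mono fun x => ?_
      rw [hUe]
      by_cases hx : x ∈ spanningSets μ k
      · simp only [hx, indicator_of_mem]
        exact ENNReal.rpow_le_rpow (min_le_right _ _) hs0.le
      · simp [hx, hs0]
  have hJ0 : J ≠ 0 := (zero_le.trans_lt hk).ne'
  set N : ℝ≥0 := (J ^ (1 / s)).toNNReal with hN
  have hNe : (N : ℝ≥0∞) = J ^ (1 / s) := ENNReal.coe_toNNReal (by
    simp [ENNReal.rpow_eq_top_iff, hJtop, hJ0])
  have hN0 : N ≠ 0 := by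
    rw [← ENNReal.coe_ne_zero, hNe]
    simp [ENNReal.rpow_eq_zero_iff, hJ0, hJtop]
  have hNs : (N : ℝ≥0∞) ^ s = J := by
    rw [hNe, ← ENNReal.rpow_mul, one_div, inv_mul_cancel₀ hs0.ne', ENNReal.rpow_one]
  let v : α → ℝ≥0 := (spanningSets μ k).indicator fun x => (U k x / N) ^ (s - 1)
  have hvm : Measurable v := (((hUm k).div_const N).pow_const (s - 1)).indicator (hS k)
  have huv : ∀ x, (U k x : ℝ≥0∞) * v x = N * ((N : ℝ≥0∞) ^ s)⁻¹ * (U k x : ℝ≥0∞) ^ s := by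
    intro x
    have hNs0 : N ^ s ≠ 0 := by simp [NNReal.rpow_eq_zero_iff, hN0]
    rw [← ENNReal.coe_rpow_of_nonneg _ hs0.le, ← ENNReal.coe_rpow_of_nonneg _ hs0.le,
      ← ENNReal.coe_inv hNs0]
    norm_cast
    by_cases hx : x ∈ spanningSets μ k
    · simp only [v, indicator_of_mem hx]
      by_cases hU0 : U k x = 0
      · simp [hU0, hs0.ne']
      · rw [NNReal.rpow_sub_one (by positivity), NNReal.div_rpow]
        field_simp
    · simp [v, U, hx, hs0.ne']
  have hvk : ∀ x, v x ≤ ((spanningSets μ k).indicator (fun _ => (k / N) ^ (s - 1)) x : ℝ≥0) := by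
    intro x
    refine indicator_le_indicator ?_
    have : U k x ≤ k := by
      rw [← ENNReal.coe_le_coe, hUe]
      refine (indicator_le_self' (fun _ _ => zero_le) x).trans ((min_le_right _ _).trans (by simp))
    have h1 : 0 ≤ s - 1 := by linarith
    gcongr
  refine ⟨v, hvm, ?_, ?_, ?_⟩
  · by_cases hq : q = ∞
    · have hp' := (ENNReal.HolderConjugate.eq_top_iff_eq_one q p).1 hq
      subst hq
      rw [eLpNorm_exponent_top]
      refine eLpNormEssSup_le_of_ae_enorm_bound (Eventually.of_forall fun x => ?_)
      have hs1 : s = 1 := by rw [hs, hp']; simp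
      simp only [enorm_eq_self, v, hs1, sub_self, NNReal.rpow_zero, ENNReal.coe_indicator]
      exact indicator_le_self' (fun _ _ => zero_le) x
    · have hq0 := ENNReal.HolderConjugate.ne_zero q p
      have h := ENNReal.HolderTriple.toReal 1 (p := p) (q := q) (ENNReal.toReal_pos hp0 hp)
        (ENNReal.toReal_pos hq0 hq)
      rw [ENNReal.toReal_one] at h
      have hqs : (s - 1) * q.toReal = s := Real.HolderConjugate.sub_one_mul_conj h
      rw [eLpNorm_eq_lintegral_rpow_enorm_toReal hq0 hq]
      refine ENNReal.rpow_le_one ?_ (by positivity)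
      have hvq : ∀ x, ‖(v x : ℝ≥0∞)‖ₑ ^ q.toReal ≤ J⁻¹ * (U k x : ℝ≥0∞) ^ s := by
        intro x
        have hNs0 : N ^ s ≠ 0 := by simp [NNReal.rpow_eq_zero_iff, hN0]
        rw [enorm_eq_self, ← hNs, ← ENNReal.coe_rpow_of_nonneg _ hs0.le,
          ← ENNReal.coe_rpow_of_nonneg _ hs0.le, ← ENNReal.coe_inv hNs0,
          ← ENNReal.coe_rpow_of_nonneg _ h.symm.nonneg]
        norm_cast
        by_cases hx : x ∈ spanningSets μ k
        · simp only [v, indicator_of_mem hx]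
          rw [← NNReal.rpow_mul, hqs, NNReal.div_rpow, div_eq_inv_mul]
        · simp [v, hx, h.symm.pos.ne']
      refine (lintegral_mono hvq).trans ?_
      rw [lintegral_const_mul _ ((hUm k).coe_nnreal_ennreal.pow_const s),
        ENNReal.inv_mul_cancel hJ0 hJtop]
  · refine ne_top_of_le_ne_top ?_ (lintegral_mono fun x => ENNReal.coe_le_coe.2 (hvk x))
    simp_rw [ENNReal.coe_indicator]
    rw [lintegral_indicator_const (hS k)]
    exact ENNReal.mul_ne_top ENNReal.coe_ne_top (hμS k).ne
  · calc l < N := by rwa [hNe, one_div, ENNReal.lt_rpow_inv_iff hs0]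
      _ = N * ((N : ℝ≥0∞) ^ s)⁻¹ * J := by
        rw [hNs, mul_assoc, ENNReal.inv_mul_cancel hJ0 hJtop, mul_one]
      _ = ∫⁻ x, (U k x : ℝ≥0∞) * v x ∂μ := by
        simp_rw [huv]
        rw [lintegral_const_mul _ ((hUm k).coe_nnreal_ennreal.pow_const s)]
      _ ≤ _ := lintegral_mono fun x => mul_le_mul_left (hUle k x) _

/-- The layer-cake formula for a single number in `[0, ∞]`. -/
lemma lintegral_layer {s : ℝ} (hs : 0 < s) (y : ℝ≥0∞) :
    ∫⁻ t in Ioi (0 : ℝ), {t : ℝ | ENNReal.ofReal t < y}.indicator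
      (fun t => ENNReal.ofReal (s * t ^ (s - 1))) t = y ^ s := by
  have hm : MeasurableSet {t : ℝ | ENNReal.ofReal t < y} :=
    measurableSet_lt ENNReal.measurable_ofReal measurable_const
  have hfin : ∀ b : ℝ, 0 ≤ b → ∫⁻ t in Ioc 0 b, ENNReal.ofReal (s * t ^ (s - 1)) =
      ENNReal.ofReal b ^ s := by
    intro b hb
    have hint : IntervalIntegrable (fun t : ℝ => s * t ^ (s - 1)) volume 0 b :=
      (intervalIntegral.intervalIntegrable_rpow' (by linarith)).const_mul s
    rw [← ofReal_integral_eq_lintegral_ofReal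
      ((intervalIntegrable_iff_integrableOn_Ioc_of_le hb).1 hint),
      ← intervalIntegral.integral_of_le hb, intervalIntegral.integral_const_mul,
      integral_rpow (Or.inl (by linarith)), ENNReal.ofReal_rpow_of_nonneg hb hs.le]
    · congr 1
      rw [sub_add_cancel, Real.zero_rpow hs.ne', sub_zero]
      field_simp
    · filter_upwards [ae_restrict_mem measurableSet_Ioc] with t ht
      have := Real.rpow_nonneg ht.1.le (s - 1)
      positivity
  rw [setLIntegral_indicator hm]
  by_cases hy : y = ∞
  · have : {t : ℝ | ENNReal.ofReal t < y} ∩ Ioi 0 = Ioi 0 := by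
      ext t; simp [hy]
    rw [this, hy, ENNReal.top_rpow_of_pos hs]
    refine ENNReal.eq_top_of_forall_nnreal_le fun c => ?_
    calc (c : ℝ≥0∞) = ENNReal.ofReal ((c : ℝ) ^ (1 / s)) ^ s := by
          rw [ENNReal.ofReal_rpow_of_nonneg (by positivity) hs.le, ← Real.rpow_mul c.coe_nonneg, one_div,
            inv_mul_cancel₀ hs.ne', Real.rpow_one, ENNReal.ofReal_coe_nnreal]
      _ = _ := (hfin _ (by positivity)).symm
      _ ≤ _ := lintegral_mono_set Ioc_subset_Ioi_self
  · lift y to ℝ≥0 using hy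
    have : {t : ℝ | ENNReal.ofReal t < y} ∩ Ioi 0 = Ioo 0 (y : ℝ) := by
      ext t
      simp only [mem_inter_iff, mem_ofPred_eq, mem_Ioi, mem_Ioo]
      constructor
      · rintro ⟨h1, h2⟩
        refine ⟨h2, ?_⟩
        rwa [← ENNReal.ofReal_coe_nnreal, ENNReal.ofReal_lt_ofReal_iff_of_nonneg h2.le] at h1
      · rintro ⟨h1, h2⟩
        refine ⟨?_, h1⟩
        rwa [← ENNReal.ofReal_coe_nnreal, ENNReal.ofReal_lt_ofReal_iff_of_nonneg h1.le]
    rw [this, setLIntegral_congr Ioo_ae_eq_Ioc]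
    exact (hfin _ y.coe_nonneg).trans (by rw [ENNReal.ofReal_coe_nnreal])

/-- The layer-cake formula for the weighted integral of a power. -/
lemma lintegral_rpow_mul_eq_layer [SFinite μ] {s : ℝ} (hs : 0 < s) {f w : α → ℝ≥0∞}
    (hf : Measurable f) (hw : Measurable w) :
    ∫⁻ x, f x ^ s * w x ∂μ = ∫⁻ t in Ioi (0 : ℝ),
      ENNReal.ofReal (s * t ^ (s - 1)) * ∫⁻ x in {x | ENNReal.ofReal t < f x}, w x ∂μ := by
  have hset : MeasurableSet {z : α × ℝ | ENNReal.ofReal z.2 < f z.1} :=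
    measurableSet_lt (ENNReal.measurable_ofReal.comp measurable_snd) (hf.comp measurable_fst)
  have hpow : Measurable fun t : ℝ => ENNReal.ofReal (s * t ^ (s - 1)) := by fun_prop
  have hm : Measurable (Function.uncurry fun (x : α) (t : ℝ) =>
      {z : α × ℝ | ENNReal.ofReal z.2 < f z.1}.indicator
        (fun z => ENNReal.ofReal (s * z.2 ^ (s - 1)) * w z.1) (x, t)) :=
    ((hpow.comp measurable_snd).mul (hw.comp measurable_fst)).indicator hset
  calc ∫⁻ x, f x ^ s * w x ∂μ
      = ∫⁻ x, (∫⁻ t in Ioi (0 : ℝ), {z : α × ℝ | ENNReal.ofReal z.2 < f z.1}.indicator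
        (fun z => ENNReal.ofReal (s * z.2 ^ (s - 1)) * w z.1) (x, t)) ∂μ := by
        refine lintegral_congr fun x => ?_
        have hm' : Measurable fun t : ℝ => {t : ℝ | ENNReal.ofReal t < f x}.indicator
            (fun t => ENNReal.ofReal (s * t ^ (s - 1))) t :=
          hpow.indicator (measurableSet_lt ENNReal.measurable_ofReal measurable_const)
        rw [← lintegral_layer hs (f x), ← lintegral_mul_const _ hm']
        refine lintegral_congr fun t => ?_
        by_cases ht : ENNReal.ofReal t < f x
        · simp [ht]
        · simp [ht]
    _ = ∫⁻ t in Ioi (0 : ℝ), (∫⁻ x, {z : α × ℝ | ENNReal.ofReal z.2 < f z.1}.indicator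
        (fun z => ENNReal.ofReal (s * z.2 ^ (s - 1)) * w z.1) (x, t) ∂μ) :=
        lintegral_lintegral_swap hm.aemeasurable
    _ = _ := by
        refine lintegral_congr fun t => ?_
        rw [← lintegral_indicator (measurableSet_lt measurable_const hf),
          ← lintegral_const_mul _ (hw.indicator (measurableSet_lt measurable_const hf))]
        refine lintegral_congr fun x => ?_
        by_cases ht : ENNReal.ofReal t < f x
        · simp [ht]
        · simp [ht]

end Integrals

lemma lowerSemicontinuousAt_inv_mul {X : Type*} [TopologicalSpace X] {b w : X → ℝ≥0∞} {x : X}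
    (hb : LowerSemicontinuousAt b x) (hw : ContinuousAt w x) (hw' : ∀ x', w x' ≠ ∞) :
    LowerSemicontinuousAt (fun x => (w x)⁻¹ * b x) x := by
  have key : ∀ {c : ℝ≥0∞} (_ : c ≠ ∞) (x' : X), c < (w x')⁻¹ * b x' ↔ c * w x' < b x' := by
    intro c hc x'
    rw [mul_comm, ← div_eq_mul_inv]
    exact ENNReal.lt_div_iff_mul_lt (Or.inr hc) (Or.inl (hw' x'))
  intro c hc
  have hc' : c ≠ ∞ := hc.ne_top
  obtain ⟨m, hm1, hm2⟩ := exists_between ((key hc' x).1 hc)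
  have h1 : Tendsto (fun x' => c * w x') (𝓝 x) (𝓝 (c * w x)) :=
    ENNReal.Tendsto.const_mul hw (Or.inr hc')
  filter_upwards [hb m hm2, h1.eventually_lt_const hm1] with x' h2 h3
  exact (key hc' x').2 (h3.trans h2)

/-! ### The Hardy--Littlewood maximal function -/

section Maximal

variable {n : ℕ}

lemma volume_ball_mul (x y : EuclideanSpace ℝ (Fin n)) {c : ℝ} (hc : 0 < c) (R : ℝ) :
    volume (ball x (c * R)) = ENNReal.ofReal c ^ n * volume (ball y R) := by
  rw [Measure.addHaar_ball_mul_of_pos _ _ hc, Measure.addHaar_ball_center _ y]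
  simp [ENNReal.ofReal_pow hc.le]

lemma volume_ball_ne_zero (x : EuclideanSpace ℝ (Fin n)) {R : ℝ} (hR : 0 < R) :
    volume (ball x R) ≠ 0 := (measure_ball_pos _ x hR).ne'

lemma volume_ball_ne_top (x : EuclideanSpace ℝ (Fin n)) (R : ℝ) :
    volume (ball x R) ≠ ∞ := measure_ball_lt_top.ne

/-- The centred Hardy--Littlewood maximal function, over open Euclidean balls. -/
noncomputable def maximalFunction (h : EuclideanSpace ℝ (Fin n) → ℝ≥0∞)
    (x : EuclideanSpace ℝ (Fin n)) : ℝ≥0∞ :=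
  ⨆ (R : ℝ) (_ : 0 < R), (volume (ball x R))⁻¹ * ∫⁻ y in ball x R, h y

variable {h : EuclideanSpace ℝ (Fin n) → ℝ≥0∞}

lemma setLIntegral_ball_le_maximalFunction (h : EuclideanSpace ℝ (Fin n) → ℝ≥0∞)
    (x : EuclideanSpace ℝ (Fin n)) {R : ℝ} (hR : 0 < R) :
    ∫⁻ y in ball x R, h y ≤ volume (ball x R) * maximalFunction h x := by
  rw [← ENNReal.inv_mul_le_iff (volume_ball_ne_zero x hR) (volume_ball_ne_top x R)]
  exact le_iSup₂_of_le (f := fun (R : ℝ) (_ : 0 < R) =>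
    (volume (ball x R))⁻¹ * ∫⁻ y in ball x R, h y) R hR le_rfl

lemma measurable_maximalFunction (hh : Measurable h) : Measurable (maximalFunction h) := by
  refine LowerSemicontinuous.measurable ?_
  refine lowerSemicontinuous_iSup fun R => lowerSemicontinuous_iSup fun hR => fun x => ?_
  refine lowerSemicontinuousAt_inv_mul (lowerSemicontinuousAt_setLIntegral
    (fun _ => measurableSet_ball) (fun w hw => ?_) hh) ?_ (fun x => volume_ball_ne_top x R)
  · rw [mem_ball] at hw
    exact (continuousAt_const.dist continuousAt_id).eventually_lt_const hw
  · have : (fun x : EuclideanSpace ℝ (Fin n) => volume (ball x R)) =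
        fun _ => volume (ball (0 : EuclideanSpace ℝ (Fin n)) R) := by
      ext x; exact Measure.addHaar_ball_center _ x R
    rw [this]
    exact continuousAt_const

/-- The weak type `(1, 1)` inequality. -/
lemma mul_volume_maximalFunction_le (h : EuclideanSpace ℝ (Fin n) → ℝ≥0∞) (l : ℝ≥0∞) :
    l * volume {x | l < maximalFunction h x} ≤ 3 ^ n * ∫⁻ y, h y := by
  -- radii are truncated at `m` so that the covering lemma applies
  let A : ℕ → Set (EuclideanSpace ℝ (Fin n)) := fun m =>
    {x | ∃ R : ℝ, 0 < R ∧ R ≤ m ∧ l * volume (ball x R) ≤ ∫⁻ y in ball x R, h y}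
  have hA : {x | l < maximalFunction h x} ⊆ ⋃ m, A m := by
    intro x hx
    rw [mem_ofPred_eq, maximalFunction] at hx
    simp only [lt_iSup_iff] at hx
    obtain ⟨R, hR, hlt⟩ := hx
    obtain ⟨m, hm⟩ := exists_nat_ge R
    refine mem_iUnion.2 ⟨m, R, hR, hm, ?_⟩
    rw [mul_comm, ← div_eq_mul_inv] at hlt
    exact ENNReal.mul_le_of_le_div hlt.le
  have hAmono : Monotone A := by
    rintro j m hjm x ⟨R, hR, hRj, hx⟩
    exact ⟨R, hR, hRj.trans (by exact_mod_cast hjm), hx⟩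
  have hAm : ∀ m, l * volume (A m) ≤ 3 ^ n * ∫⁻ y, h y := by
    intro m
    let t : Set (EuclideanSpace ℝ (Fin n) × ℝ) :=
      {z | 0 < z.2 ∧ z.2 ≤ m ∧ l * volume (ball z.1 z.2) ≤ ∫⁻ y in ball z.1 z.2, h y}
    obtain ⟨u, hut, hdisj, hcov⟩ := Vitali.exists_disjoint_subfamily_covering_enlargement
      (fun z : EuclideanSpace ℝ (Fin n) × ℝ => ball z.1 z.2) t (fun z => z.2) 2 one_lt_two
      (fun z hz => hz.1.le) m (fun z hz => hz.2.1) (fun z hz => ⟨z.1, mem_ball_self hz.1⟩)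
    have hcount : u.Countable := hdisj.countable_of_isOpen (fun _ _ => isOpen_ball)
      (fun z hz => ⟨z.1, mem_ball_self (hut hz).1⟩)
    have hsub : A m ⊆ ⋃ z ∈ u, ball z.1 (3 * z.2) := by
      rintro x ⟨R, hR, hRm, hx⟩
      obtain ⟨b, hb, ⟨y, hy1, hy2⟩, hRb⟩ := hcov (x, R) ⟨hR, hRm, hx⟩
      refine mem_iUnion₂.2 ⟨b, hb, ?_⟩
      simp only [mem_ball] at hy1 hy2 hRb ⊢
      have := dist_triangle x y b.1
      rw [dist_comm] at hy1
      linarith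
    calc l * volume (A m) ≤ l * ∑' z : u, volume (ball z.1.1 (3 * z.1.2)) := by
          gcongr
          exact (measure_mono hsub).trans (measure_biUnion_le _ hcount _)
      _ = 3 ^ n * ∑' z : u, l * volume (ball z.1.1 z.1.2) := by
          simp_rw [fun z : u => volume_ball_mul z.1.1 z.1.1 three_pos z.1.2,
            ENNReal.tsum_mul_left, ENNReal.ofReal_ofNat]
          ring
      _ ≤ 3 ^ n * ∑' z : u, ∫⁻ y in ball z.1.1 z.1.2, h y := by
          gcongr with z
          exact (hut z.2).2.2
      _ = 3 ^ n * ∫⁻ y in ⋃ z ∈ u, ball z.1 z.2, h y := by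
          rw [lintegral_biUnion hcount (fun _ _ => measurableSet_ball) hdisj]
      _ ≤ 3 ^ n * ∫⁻ y, h y := by
          exact mul_le_mul_right (setLIntegral_le_lintegral _ _) _
  calc l * volume {x | l < maximalFunction h x} ≤ l * volume (⋃ m, A m) := by gcongr
    _ = ⨆ m, l * volume (A m) := by rw [hAmono.measure_iUnion, ENNReal.mul_iSup]
    _ ≤ _ := iSup_le hAm

/-- Only the part of `h` above height `l` matters for the level set of the maximal function at
height `2l`. -/
lemma mul_volume_two_mul_lt_maximalFunction_le (hh : Measurable h) (l : ℝ≥0∞) :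
    l * volume {x | 2 * l < maximalFunction h x} ≤ 3 ^ n * ∫⁻ y in {y | l < h y}, h y := by
  have hS : MeasurableSet {y | l < h y} := measurableSet_lt measurable_const hh
  rw [← lintegral_indicator hS]
  refine le_trans (mul_le_mul_right (measure_mono fun x hx => ?_) _)
    (mul_volume_maximalFunction_le _ l)
  rw [mem_ofPred_eq] at hx ⊢
  by_contra! hcon
  refine hx.not_ge ?_
  rw [maximalFunction]
  refine iSup₂_le fun R hR => ?_
  have hV0 := volume_ball_ne_zero x hR
  have hVt := volume_ball_ne_top x R
  calc (volume (ball x R))⁻¹ * ∫⁻ y in ball x R, h y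
      ≤ (volume (ball x R))⁻¹ * ∫⁻ y in ball x R, ({y | l < h y}.indicator h y + l) := by
        gcongr with y
        by_cases hy : l < h y
        · simp [hy]
        · simpa [hy] using not_lt.1 hy
    _ = (volume (ball x R))⁻¹ * (∫⁻ y in ball x R, {y | l < h y}.indicator h y) + l := by
        rw [lintegral_add_right _ measurable_const, setLIntegral_const, mul_add, mul_comm l,
          ENNReal.inv_mul_cancel_left' (by simp [hV0]) (by simp [hVt])]
    _ ≤ l + l := by
        gcongr
        rw [ENNReal.inv_mul_le_iff hV0 hVt]
        exact (setLIntegral_ball_le_maximalFunction _ x hR).trans (by gcongr)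
    _ = 2 * l := (two_mul l).symm

/-- The maximal theorem: the Hardy--Littlewood maximal function is bounded on `L_p`, `p > 1`. -/
theorem exists_eLpNorm_maximalFunction_le (n : ℕ) {p : ℝ≥0∞} (hp : 1 < p) :
    ∃ C : ℝ≥0, ∀ h : EuclideanSpace ℝ (Fin n) → ℝ≥0∞, Measurable h →
      eLpNorm (maximalFunction h) p volume ≤ C * eLpNorm h p volume := by
  by_cases hptop : p = ∞
  · subst hptop
    refine ⟨1, fun h _ => ?_⟩
    rw [ENNReal.coe_one, one_mul, eLpNorm_exponent_top, eLpNorm_exponent_top]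
    refine eLpNormEssSup_le_of_ae_enorm_bound (Eventually.of_forall fun x => ?_)
    rw [enorm_eq_self, maximalFunction]
    refine iSup₂_le fun R hR => ?_
    rw [ENNReal.inv_mul_le_iff (volume_ball_ne_zero x hR) (volume_ball_ne_top x R), mul_comm,
      ← setLIntegral_const]
    refine setLIntegral_mono_ae' measurableSet_ball ?_
    filter_upwards [enorm_ae_le_eLpNormEssSup h volume] with y hy _ using hy
  have hs : 1 < p.toReal := by
    simpa using ENNReal.toReal_strict_mono hptop hp
  set s := p.toReal with hsdef
  have hs0 : 0 < s := by linarith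
  have hs1 : 0 < s - 1 := by linarith
  have hp0 : p ≠ 0 := (zero_lt_one.trans hp).ne'
  let K : ℝ≥0 := 2 ^ s * (3 ^ n * (s / (s - 1)).toNNReal)
  refine ⟨K ^ (1 / s), fun h hh => ?_⟩
  have key : ∫⁻ x, maximalFunction h x ^ s ≤ K * ∫⁻ y, h y ^ s := by
    have hM : Measurable fun x => 2⁻¹ * maximalFunction h x :=
      (measurable_maximalFunction hh).const_mul _
    calc ∫⁻ x, maximalFunction h x ^ s
        = 2 ^ s * ∫⁻ x, (2⁻¹ * maximalFunction h x) ^ s * 1 := by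
          rw [← lintegral_const_mul _ ((hM.pow_const s).mul_const 1)]
          refine lintegral_congr fun x => ?_
          rw [mul_one, ← ENNReal.mul_rpow_of_nonneg _ _ hs0.le, ← mul_assoc,
            ENNReal.mul_inv_cancel two_ne_zero ENNReal.ofNat_ne_top, one_mul]
      _ = 2 ^ s * ∫⁻ t in Ioi (0 : ℝ), ENNReal.ofReal (s * t ^ (s - 1)) *
            volume {x | ENNReal.ofReal t < 2⁻¹ * maximalFunction h x} := by
          rw [lintegral_rpow_mul_eq_layer hs0 hM measurable_const]
          simp
      _ ≤ 2 ^ s * ∫⁻ t in Ioi (0 : ℝ), 3 ^ n * ENNReal.ofReal (s / (s - 1)) *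
            (ENNReal.ofReal ((s - 1) * t ^ (s - 1 - 1)) *
              ∫⁻ y in {y | ENNReal.ofReal t < h y}, h y) := by
          gcongr 2 ^ s * ?_
          refine setLIntegral_mono' measurableSet_Ioi fun t ht => ?_
          have ht : 0 < t := ht
          have h1 : ENNReal.ofReal (s * t ^ (s - 1)) = ENNReal.ofReal (s / (s - 1)) *
              ENNReal.ofReal ((s - 1) * t ^ (s - 1 - 1)) * ENNReal.ofReal t := by
            rw [← ENNReal.ofReal_mul (by positivity), ← ENNReal.ofReal_mul (by positivity),
              Real.rpow_sub_one ht.ne' (s - 1)]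
            congr 1
            field_simp
          have h2 : {x | ENNReal.ofReal t < 2⁻¹ * maximalFunction h x} ⊆
              {x | 2 * ENNReal.ofReal t < maximalFunction h x} := by
            intro x hx
            rw [mem_ofPred_eq, mul_comm, ← div_eq_mul_inv] at hx
            rw [mem_ofPred_eq, mul_comm]
            exact (ENNReal.lt_div_iff_mul_lt (by simp) (by simp)).1 hx
          calc ENNReal.ofReal (s * t ^ (s - 1)) *
                volume {x | ENNReal.ofReal t < 2⁻¹ * maximalFunction h x}
              ≤ ENNReal.ofReal (s * t ^ (s - 1)) *
                volume {x | 2 * ENNReal.ofReal t < maximalFunction h x} :=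
                mul_le_mul_right (measure_mono h2) _
            _ = ENNReal.ofReal (s / (s - 1)) * ENNReal.ofReal ((s - 1) * t ^ (s - 1 - 1)) *
                (ENNReal.ofReal t * volume {x | 2 * ENNReal.ofReal t < maximalFunction h x}) := by
                rw [h1]; ring
            _ ≤ ENNReal.ofReal (s / (s - 1)) * ENNReal.ofReal ((s - 1) * t ^ (s - 1 - 1)) *
                (3 ^ n * ∫⁻ y in {y | ENNReal.ofReal t < h y}, h y) := by
                exact mul_le_mul_right
                  (mul_volume_two_mul_lt_maximalFunction_le hh _) _
            _ = _ := by ring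
      _ = 2 ^ s * (3 ^ n * ENNReal.ofReal (s / (s - 1))) * ∫⁻ y, h y ^ (s - 1) * h y := by
          rw [lintegral_rpow_mul_eq_layer hs1 hh hh, mul_assoc,
            lintegral_const_mul' _ _ (ENNReal.mul_ne_top (by simp) ENNReal.ofReal_ne_top)]
      _ = K * ∫⁻ y, h y ^ s := by
          congr 1
          · simp only [K, ENNReal.ofReal]
            push_cast
            rw [ENNReal.coe_rpow_of_nonneg _ hs0.le]
            simp
          · refine lintegral_congr fun y => ?_
            nth_rewrite 2 [← ENNReal.rpow_one (h y)]
            rw [← ENNReal.rpow_add_of_nonneg _ _ hs1.le zero_le_one]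
            simp
  rw [eLpNorm_eq_lintegral_rpow_enorm_toReal hp0 hptop,
    eLpNorm_eq_lintegral_rpow_enorm_toReal hp0 hptop, ENNReal.coe_rpow_of_nonneg _ (by positivity),
    ← ENNReal.mul_rpow_of_nonneg _ _ (by positivity)]
  simp only [enorm_eq_self, ← hsdef]
  gcongr

end Maximal

/-! ### Cubes, Whitney regions and Whitney averages -/

section Geometry

variable {n : ℕ}

lemma isOpen_cube (b : EuclideanSpace ℝ (Fin n)) (l : ℝ) : IsOpen (cube b l) := by
  have : cube b l = ⋂ i, {y | b i < y i ∧ y i < b i + l} := by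
    ext y; simp [cube]
  rw [this]
  refine isOpen_iInter_of_finite fun i => ?_
  refine IsOpen.and (isOpen_lt ?_ ?_) (isOpen_lt ?_ ?_) <;> fun_prop

lemma measurableSet_cube (b : EuclideanSpace ℝ (Fin n)) (l : ℝ) : MeasurableSet (cube b l) :=
  (isOpen_cube b l).measurableSet

lemma measurableSet_carlesonBox (b : EuclideanSpace ℝ (Fin n)) (l : ℝ) :
    MeasurableSet (carlesonBox b l) := measurableSet_Ioo.prod (measurableSet_cube b l)

/-- The lower corner of the cube with centre `x` and sidelength `2R`. For negative `R` the point is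
moved up instead: `cubeCorner b (-(l / 2))` is the centre of the cube with corner `b` and
sidelength `l`. -/
noncomputable def cubeCorner (x : EuclideanSpace ℝ (Fin n)) (R : ℝ) : EuclideanSpace ℝ (Fin n) :=
  WithLp.toLp 2 fun i => x i - R

lemma ball_subset_cube (x : EuclideanSpace ℝ (Fin n)) (R : ℝ) :
    ball x R ⊆ cube (cubeCorner x R) (2 * R) := by
  intro y hy i
  rw [mem_ball, dist_eq_norm] at hy
  have h := (PiLp.norm_apply_le (y - x) i).trans_lt hy
  rw [PiLp.sub_apply, Real.norm_eq_abs, abs_lt] at h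
  simp only [cubeCorner]
  constructor <;> linarith

lemma ball_subset_cube' (b : EuclideanSpace ℝ (Fin n)) (l : ℝ) :
    ball (cubeCorner b (-(l / 2))) (l / 2) ⊆ cube b l := by
  convert ball_subset_cube (cubeCorner b (-(l / 2))) (l / 2) using 2
  · ext i; simp [cubeCorner]
  · ring

lemma dist_le_of_mem_cube {b x y : EuclideanSpace ℝ (Fin n)} {l : ℝ} (hx : x ∈ cube b l)
    (hy : y ∈ cube b l) : dist x y ≤ n * l := by
  have hn : ∀ i, |x i - y i| ≤ l := fun i => by
    have h1 := hx i
    have h2 := hy i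
    rw [abs_le]; constructor <;> linarith
  have hl : ∀ i : Fin n, 0 ≤ l := fun i => (abs_nonneg _).trans (hn i)
  have hnl : 0 ≤ n * l := by
    rcases Nat.eq_zero_or_pos n with h | h
    · simp [h]
    · exact mul_nonneg n.cast_nonneg (hl ⟨0, h⟩)
  rw [EuclideanSpace.dist_eq, Real.sqrt_le_left hnl]
  calc ∑ i, dist (x i) (y i) ^ 2 ≤ ∑ _i : Fin n, l ^ 2 := by
        gcongr with i
        rw [Real.dist_eq]; exact hn i
    _ = n * l ^ 2 := by simp
    _ ≤ (n * l) ^ 2 := by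
        rw [mul_pow]
        gcongr
        have : n ≤ n ^ 2 := Nat.le_self_pow two_ne_zero n
        exact_mod_cast this

lemma cube_subset_ball {b x : EuclideanSpace ℝ (Fin n)} {l : ℝ} (hl : 0 < l) (hx : x ∈ cube b l) :
    cube b l ⊆ ball x ((n + 1) * l) := fun y hy => by
  rw [mem_ball]
  have := dist_le_of_mem_cube hy hx
  linarith

lemma volume_cube_ne_zero (b : EuclideanSpace ℝ (Fin n)) {l : ℝ} (hl : 0 < l) :
    volume (cube b l) ≠ 0 := fun h =>
  volume_ball_ne_zero _ (half_pos hl) (measure_mono_null (ball_subset_cube' b l) h)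

lemma mem_cube_center (b : EuclideanSpace ℝ (Fin n)) {l : ℝ} (hl : 0 < l) :
    cubeCorner b (-(l / 2)) ∈ cube b l :=
  ball_subset_cube' b l (mem_ball_self (half_pos hl))

lemma volume_cube_ne_top (b : EuclideanSpace ℝ (Fin n)) (l : ℝ) : volume (cube b l) ≠ ∞ := by
  by_cases h : (cube b l).Nonempty
  · obtain ⟨x, hx⟩ := h
    have hsub : cube b l ⊆ closedBall x (n * l) := fun y hy => dist_le_of_mem_cube hy hx
    exact ((measure_mono hsub).trans_lt measure_closedBall_lt_top).ne
  · rw [not_nonempty_iff_eq_empty] at h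
    simp [h]

/-- Cubes and balls of comparable size have comparable volume. -/
lemma volume_ball_le_volume_cube (x b : EuclideanSpace ℝ (Fin n)) {c l : ℝ} (hc : 0 < c) :
    volume (ball x (c * l)) ≤ ENNReal.ofReal (2 * c) ^ n * volume (cube b l) := by
  rw [show c * l = (2 * c) * (l / 2) by ring, volume_ball_mul x (cubeCorner b (-(l / 2))) (by positivity)]
  exact mul_le_mul_right (measure_mono (ball_subset_cube' b l)) _

lemma volume_cube_le_volume_ball (x b : EuclideanSpace ℝ (Fin n)) {c l : ℝ} (hc : 0 < c)
    (hl : 0 < l) :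
    volume (cube b l) ≤ ENNReal.ofReal ((n + 1) / c) ^ n * volume (ball x (c * l)) := by
  rw [← volume_ball_mul (cubeCorner b (-(l / 2))) x (by positivity),
    show (n + 1) / c * (c * l) = (n + 1) * l by field_simp]
  exact measure_mono (cube_subset_ball hl (mem_cube_center b hl))

lemma measurableSet_halfSpace : MeasurableSet (halfSpace n) :=
  measurableSet_lt measurable_const measurable_fst

variable {c₀ c₁ : ℝ}

lemma mem_whitneyRegion_iff (hc₀ : 1 < c₀) {z w : Space n} :
    w ∈ whitneyRegion c₀ c₁ z ↔
      0 < w.1 ∧ 0 < z.1 ∧ ‖w.2 - z.2‖ < c₁ * z.1 ∧ z.1 < c₀ * w.1 ∧ w.1 < c₀ * z.1 := by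
  have hc : 0 < c₀ := by linarith
  simp only [whitneyRegion, halfSpace, mem_ofPred_eq]
  constructor
  · rintro ⟨h1, h2, h3, h4⟩
    have hz : 0 < z.1 := by
      by_contra! h
      have := div_nonpos_of_nonneg_of_nonpos h1.le h
      have : 0 < c₀⁻¹ := by positivity
      linarith
    rw [lt_div_iff₀ hz, inv_mul_lt_iff₀ hc] at h3
    rw [div_lt_iff₀ hz] at h4
    exact ⟨h1, hz, h2, h3, h4⟩
  · rintro ⟨h1, hz, h2, h3, h4⟩
    refine ⟨h1, h2, ?_, ?_⟩
    · rwa [lt_div_iff₀ hz, inv_mul_lt_iff₀ hc]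
    · rwa [div_lt_iff₀ hz]

lemma isOpen_mem_whitneyRegion (hc₀ : 1 < c₀) :
    IsOpen {x : Space n × Space n | x.2 ∈ whitneyRegion c₀ c₁ x.1} := by
  simp_rw [mem_whitneyRegion_iff hc₀]
  refine IsOpen.and (isOpen_lt ?_ ?_) (IsOpen.and (isOpen_lt ?_ ?_) (IsOpen.and (isOpen_lt ?_ ?_)
    (IsOpen.and (isOpen_lt ?_ ?_) (isOpen_lt ?_ ?_)))) <;> fun_prop

lemma isOpen_whitneyRegion (hc₀ : 1 < c₀) (z : Space n) : IsOpen (whitneyRegion c₀ c₁ z) :=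
  (isOpen_mem_whitneyRegion hc₀).preimage (Continuous.prodMk_right z)

lemma isOpen_setOf_mem_whitneyRegion (hc₀ : 1 < c₀) (w : Space n) :
    IsOpen {z | w ∈ whitneyRegion c₀ c₁ z} :=
  (isOpen_mem_whitneyRegion hc₀).preimage (Continuous.prodMk_left w)

lemma measurableSet_whitneyRegion (hc₀ : 1 < c₀) (z : Space n) :
    MeasurableSet (whitneyRegion c₀ c₁ z) := (isOpen_whitneyRegion hc₀ z).measurableSet

lemma mem_whitneyRegion_self (hc₀ : 1 < c₀) (hc₁ : 0 < c₁) {z : Space n} (hz : 0 < z.1) :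
    z ∈ whitneyRegion c₀ c₁ z := by
  rw [mem_whitneyRegion_iff hc₀]
  refine ⟨hz, hz, ?_, ?_, ?_⟩
  · simp; positivity
  · nlinarith
  · nlinarith

lemma whitneyRegion_eq_prod (hc₀ : 1 < c₀) {z : Space n} (hz : 0 < z.1) :
    whitneyRegion c₀ c₁ z = Ioo (z.1 * c₀⁻¹) (z.1 * c₀) ×ˢ ball z.2 (z.1 * c₁) := by
  have hc : 0 < c₀ := by linarith
  ext w
  rw [mem_whitneyRegion_iff hc₀, mem_prod, mem_Ioo, mem_ball, dist_eq_norm,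
    mul_inv_lt_iff₀ hc]
  constructor
  · rintro ⟨h1, h2, h3, h4, h5⟩
    exact ⟨⟨by linarith, by linarith⟩, by linarith⟩
  · rintro ⟨⟨h1, h2⟩, h3⟩
    have : 0 < w.1 := by
      by_contra! h
      have := mul_nonpos_of_nonpos_of_nonneg h hc.le
      linarith
    exact ⟨this, hz, by linarith, by linarith, by linarith⟩

lemma exists_volume_whitneyRegion_eq (n : ℕ) (hc₀ : 1 < c₀) (hc₁ : 0 < c₁) :
    ∃ K : ℝ≥0, K ≠ 0 ∧ ∀ z : Space n,
      volume (whitneyRegion c₀ c₁ z) = K * ENNReal.ofReal z.1 ^ (n + 1) := by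
  have hc : 0 < c₀ := by linarith
  have hcc : 0 < c₀ - c₀⁻¹ := by
    have := inv_lt_one_of_one_lt₀ hc₀
    linarith
  set V := volume (ball (0 : EuclideanSpace ℝ (Fin n)) c₁)
  refine ⟨(c₀ - c₀⁻¹).toNNReal * V.toNNReal, ?_, fun z => ?_⟩
  · refine mul_ne_zero (by simpa using hcc) ?_
    rw [Ne, ENNReal.toNNReal_eq_zero_iff, not_or]
    exact ⟨volume_ball_ne_zero _ hc₁, volume_ball_ne_top _ _⟩
  · by_cases hz : 0 < z.1
    · rw [whitneyRegion_eq_prod hc₀ hz, Measure.volume_eq_prod, Measure.prod_prod, Real.volume_Ioo,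
        volume_ball_mul _ 0 hz, ← mul_sub, ENNReal.ofReal_mul hz.le, ENNReal.coe_mul,
        ENNReal.coe_toNNReal (volume_ball_ne_top _ _)]
      simp only [ENNReal.ofReal]
      ring
    · have : whitneyRegion c₀ c₁ z = ∅ := by
        ext w
        rw [mem_whitneyRegion_iff hc₀]
        simp [hz]
      simp [this, ENNReal.ofReal_of_nonpos (not_lt.1 hz)]

lemma volume_whitneyRegion_ne_top (hc₀ : 1 < c₀) (hc₁ : 0 < c₁) (z : Space n) :
    volume (whitneyRegion c₀ c₁ z) ≠ ∞ := by
  obtain ⟨K, _, hK⟩ := exists_volume_whitneyRegion_eq n hc₀ hc₁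
  rw [hK]
  finiteness

lemma volume_whitneyRegion_ne_zero (hc₀ : 1 < c₀) (hc₁ : 0 < c₁) {z : Space n} (hz : 0 < z.1) :
    volume (whitneyRegion c₀ c₁ z) ≠ 0 := by
  obtain ⟨K, hK0, hK⟩ := exists_volume_whitneyRegion_eq n hc₀ hc₁
  rw [hK]
  simp [hK0, hz]

lemma continuous_volume_whitneyRegion (hc₀ : 1 < c₀) (hc₁ : 0 < c₁) :
    Continuous fun z : Space n => volume (whitneyRegion c₀ c₁ z) := by
  obtain ⟨K, _, hK⟩ := exists_volume_whitneyRegion_eq n hc₀ hc₁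
  simp_rw [hK]
  refine ENNReal.continuous_const_mul (by simp) |>.comp ?_
  exact (ENNReal.continuous_pow _).comp (ENNReal.continuous_ofReal.comp continuous_fst)

/-- Whitney regions, possibly of different shapes, at comparable heights have comparable volume. -/
lemma exists_volume_whitneyRegion_le (n : ℕ) (hc₀ : 1 < c₀) (hc₁ : 0 < c₁) {d₀ d₁ : ℝ}
    (hd₀ : 1 < d₀) (hd₁ : 0 < d₁) {D : ℝ} (hD : 0 ≤ D) :
    ∃ C : ℝ≥0, ∀ z w : Space n, z.1 ≤ D * w.1 →
      volume (whitneyRegion c₀ c₁ z) ≤ C * volume (whitneyRegion d₀ d₁ w) := by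
  obtain ⟨K, _, hK⟩ := exists_volume_whitneyRegion_eq n hc₀ hc₁
  obtain ⟨L, hL0, hL⟩ := exists_volume_whitneyRegion_eq n hd₀ hd₁
  refine ⟨K * D.toNNReal ^ (n + 1) * L⁻¹, fun z w h => ?_⟩
  rw [hK, hL]
  calc (K : ℝ≥0∞) * ENNReal.ofReal z.1 ^ (n + 1)
      ≤ K * (ENNReal.ofReal D * ENNReal.ofReal w.1) ^ (n + 1) := by
        rw [← ENNReal.ofReal_mul hD]
        gcongr
    _ = K * D.toNNReal ^ (n + 1) * (L⁻¹ * L) * ENNReal.ofReal w.1 ^ (n + 1) := by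
        rw [← ENNReal.coe_mul L⁻¹, inv_mul_cancel₀ hL0, ENNReal.coe_one]
        simp only [ENNReal.ofReal]
        ring
    _ = _ := by
        push_cast
        ring

/-- The Whitney average `|W(z)|^(-1/q) ‖u‖_{L_q(W(z))}` of a function with values in `[0, ∞]`. -/
noncomputable def whitneyMean (c₀ c₁ : ℝ) (q : ℝ≥0∞) (u : Space n → ℝ≥0∞) (z : Space n) : ℝ≥0∞ :=
  (volume (whitneyRegion c₀ c₁ z)) ^ (-(1 / q).toReal) *
    eLpNorm u q (volume.restrict (whitneyRegion c₀ c₁ z))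

lemma lowerSemicontinuous_whitneyMean (hc₀ : 1 < c₀) (hc₁ : 0 < c₁) {q : ℝ≥0∞} (hq : q ≠ 0)
    {u : Space n → ℝ≥0∞} (hu : Measurable u) :
    LowerSemicontinuous (whitneyMean c₀ c₁ q u) := by
  have hint : ∀ {f : Space n → ℝ≥0∞}, Measurable f → ∀ z, LowerSemicontinuousAt
      (fun z => ∫⁻ w in whitneyRegion c₀ c₁ z, f w) z := fun hf z =>
    lowerSemicontinuousAt_setLIntegral (measurableSet_whitneyRegion hc₀)
      (fun w hw => (isOpen_setOf_mem_whitneyRegion hc₀ w).mem_nhds hw) hf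
  intro z
  unfold whitneyMean
  simp_rw [ENNReal.rpow_neg]
  refine lowerSemicontinuousAt_inv_mul ?_ ?_ fun z' => ?_
  · by_cases hqt : q = ∞
    · subst hqt
      intro y hy
      simp only [eLpNorm_exponent_top, eLpNormEssSup, enorm_eq_self] at hy ⊢
      have hms : MeasurableSet {w | y < u w} := measurableSet_lt measurable_const hu
      have hiff : ∀ z : Space n, 0 < ∫⁻ w in whitneyRegion c₀ c₁ z,
          {w | y < u w}.indicator 1 w ↔
            ¬ essSup u (volume.restrict (whitneyRegion c₀ c₁ z)) ≤ y := by
        intro z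
        rw [lintegral_indicator_one hms, pos_iff_ne_zero, not_iff_not]
        constructor
        · intro h0
          refine essSup_le_of_ae_le y ?_
          rw [EventuallyLE, ae_iff]
          simpa using h0
        · intro hle
          have := (ae_le_essSup (f := u) (μ := volume.restrict (whitneyRegion c₀ c₁ z)))
          rw [ae_iff] at this
          refine measure_mono_null (fun w hw => ?_) this
          exact not_le.2 (hle.trans_lt hw)
      have h1 := hint (measurable_one.indicator hms) z 0 ((hiff z).2 (not_le.2 hy))
      filter_upwards [h1] with z' hz'
      exact not_le.1 ((hiff z').1 hz')
    · have hq0 : 0 < q.toReal := ENNReal.toReal_pos hq hqt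
      intro y hy
      simp only [eLpNorm_eq_lintegral_rpow_enorm_toReal hq hqt, enorm_eq_self, one_div,
        ENNReal.lt_rpow_inv_iff hq0] at hy ⊢
      exact hint (hu.pow_const _) z _ hy
  · exact (ENNReal.continuous_rpow_const.comp
      (continuous_volume_whitneyRegion hc₀ hc₁)).continuousAt
  · exact ENNReal.rpow_ne_top_of_nonneg ENNReal.toReal_nonneg
      (volume_whitneyRegion_ne_top hc₀ hc₁ z')

lemma measurable_whitneyMean (hc₀ : 1 < c₀) (hc₁ : 0 < c₁) {q : ℝ≥0∞} (hq : q ≠ 0)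
    {u : Space n → ℝ≥0∞} (hu : Measurable u) : Measurable (whitneyMean c₀ c₁ q u) :=
  (lowerSemicontinuous_whitneyMean hc₀ hc₁ hq hu).measurable

lemma measurable_nontangentialMax {F : Space n → ℝ≥0∞} (a : ℝ) (ha : 0 < a)
    (hF : LowerSemicontinuous F) : Measurable (nontangentialMax a F) := by
  refine LowerSemicontinuous.measurable fun y l hl => ?_
  simp only [nontangentialMax, lt_iSup_iff] at hl
  obtain ⟨z, ⟨hz, hzy⟩, hlz⟩ := hl
  -- moving `z` up leaves room for moving `y`
  have hcont : ContinuousAt (fun t : ℝ => ((t, z.2) : Space n)) z.1 := by fun_prop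
  have hev : ∀ᶠ t in 𝓝[>] z.1, l < F (t, z.2) :=
    (hcont.eventually (hF z l hlz)).filter_mono nhdsWithin_le_nhds
  obtain ⟨t, hlt, ht⟩ := (hev.and self_mem_nhdsWithin).exists
  have ht' : z.1 < t := ht
  have hlt2 : ‖z.2 - y‖ < a * t := by nlinarith
  have hy : ∀ᶠ y' in 𝓝 y, ‖z.2 - y'‖ < a * t :=
    (by fun_prop : ContinuousAt (fun y' => ‖z.2 - y'‖) y).eventually_lt_const hlt2
  filter_upwards [hy] with y' hy'
  refine lt_of_lt_of_le hlt (le_iSup₂_of_le (f := fun (z : Space n)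
    (_ : z ∈ halfSpace n ∧ ‖z.2 - y'‖ ≤ a * z.1) => F z) (t, z.2) ⟨?_, hy'.le⟩ le_rfl)
  exact lt_trans (show 0 < z.1 from hz) ht'

lemma measurable_carlesonFunctional (r : ℝ) (F : Space n → ℝ≥0∞) :
    Measurable (carlesonFunctional r F) := by
  refine LowerSemicontinuous.measurable fun x l hl => ?_
  simp only [carlesonFunctional, lt_iSup_iff] at hl
  obtain ⟨b, k, ⟨hk, hx⟩, hl⟩ := hl
  filter_upwards [(isOpen_cube b k).mem_nhds hx] with x' hx'
  simp only [carlesonFunctional, lt_iSup_iff]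
  exact ⟨b, k, ⟨hk, hx'⟩, hl⟩

lemma setLIntegral_carlesonBox_le (F : Space n → ℝ≥0∞) {b x : EuclideanSpace ℝ (Fin n)} {l : ℝ}
    (hl : 0 < l) (hx : x ∈ cube b l) :
    ∫⁻ z in carlesonBox b l, F z ≤ volume (cube b l) * carlesonFunctional 1 F x := by
  rw [← ENNReal.inv_mul_le_iff (volume_cube_ne_zero b hl) (volume_cube_ne_top b l)]
  have : boxMean 1 F b l ≤ carlesonFunctional 1 F x :=
    le_iSup_of_le b (le_iSup_of_le l (le_iSup_of_le (ι := 0 < l ∧ x ∈ cube b l) ⟨hl, hx⟩ le_rfl))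
  simpa [boxMean] using this

lemma carlesonFunctional_one_le {F : Space n → ℝ≥0∞} {x : EuclideanSpace ℝ (Fin n)} {B : ℝ≥0∞}
    (h : ∀ b l, 0 < l → x ∈ cube b l →
      ∫⁻ z in carlesonBox b l, F z ≤ volume (cube b l) * B) : carlesonFunctional 1 F x ≤ B := by
  refine iSup_le fun b => iSup_le fun l => iSup_le fun hl => ?_
  simp only [boxMean, ENNReal.rpow_one, one_div, inv_one]
  rw [ENNReal.inv_mul_le_iff (volume_cube_ne_zero b hl.1) (volume_cube_ne_top b l)]
  exact h b l hl.1 hl.2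

/-- The integral over the half space is controlled by the integral of the Whitney averages. -/
lemma exists_lintegral_le_lintegral_average (n : ℕ) (hc₀ : 1 < c₀) (hc₁ : 0 < c₁) :
    ∃ C : ℝ≥0, ∀ h : Space n → ℝ≥0∞, Measurable h → ∫⁻ w in halfSpace n, h w ≤
      C * ∫⁻ z in halfSpace n,
        (volume (whitneyRegion c₀ c₁ z))⁻¹ * ∫⁻ w in whitneyRegion c₀ c₁ z, h w := by
  have hc : 0 < c₀ := by linarith
  have hd₁ : 0 < c₁ / c₀ := by positivity
  obtain ⟨C, hC⟩ := exists_volume_whitneyRegion_le n hc₀ hc₁ hc₀ hd₁ hc.le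
  refine ⟨C, fun h hh => ?_⟩
  have hmV : Measurable fun z : Space n => (volume (whitneyRegion c₀ c₁ z))⁻¹ :=
    (continuous_volume_whitneyRegion hc₀ hc₁).measurable.inv
  have hmW := (isOpen_mem_whitneyRegion (n := n) (c₁ := c₁) hc₀).measurableSet
  have hmS : Measurable fun x : Space n × Space n => (volume (whitneyRegion c₀ c₁ x.1))⁻¹ *
      {x : Space n × Space n | x.2 ∈ whitneyRegion c₀ c₁ x.1}.indicator (fun x => h x.2) x :=
    (hmV.comp measurable_fst).mul ((hh.comp measurable_snd).indicator hmW)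
  calc ∫⁻ w in halfSpace n, h w
      ≤ ∫⁻ w in halfSpace n, C * ∫⁻ z in halfSpace n, (volume (whitneyRegion c₀ c₁ z))⁻¹ *
        {x : Space n × Space n | x.2 ∈ whitneyRegion c₀ c₁ x.1}.indicator (fun x => h x.2) (z, w) := by
        refine setLIntegral_mono' measurableSet_halfSpace fun w hw => ?_
        have hw : 0 < w.1 := hw
        set V := volume (whitneyRegion c₀ (c₁ / c₀) w) with hV
        have hV0 : V ≠ 0 := volume_whitneyRegion_ne_zero hc₀ hd₁ hw
        have hVt : V ≠ ∞ := volume_whitneyRegion_ne_top hc₀ hd₁ w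
        have hpt : ∀ z ∈ whitneyRegion c₀ (c₁ / c₀) w, V⁻¹ * h w ≤ C *
            ((volume (whitneyRegion c₀ c₁ z))⁻¹ *
              {x : Space n × Space n | x.2 ∈ whitneyRegion c₀ c₁ x.1}.indicator
                (fun x => h x.2) (z, w)) := by
          intro z hz
          rw [mem_whitneyRegion_iff hc₀] at hz
          obtain ⟨h1, h2, h3, h4, h5⟩ := hz
          have hmem : w ∈ whitneyRegion c₀ c₁ z := by
            rw [mem_whitneyRegion_iff hc₀]
            refine ⟨h2, h1, ?_, h5, h4⟩
            rw [norm_sub_rev]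
            refine h3.trans ?_
            rw [div_mul_eq_mul_div, div_lt_iff₀ hc]
            nlinarith
          rw [indicator_of_mem (by exact hmem), ← mul_assoc]
          gcongr ?_ * h w
          have hle := hC z w h5.le
          have hW0 := volume_whitneyRegion_ne_zero hc₀ hc₁ h1
          have hWt := volume_whitneyRegion_ne_top hc₀ hc₁ z
          rw [← div_eq_mul_inv, ENNReal.le_div_iff_mul_le (Or.inl hW0) (Or.inl hWt), mul_comm,
            ← div_eq_mul_inv]
          exact ENNReal.div_le_of_le_mul hle
        calc h w = ∫⁻ z in whitneyRegion c₀ (c₁ / c₀) w, V⁻¹ * h w := by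
              rw [setLIntegral_const, mul_assoc, mul_comm, mul_assoc,
                ENNReal.mul_inv_cancel hV0 hVt, mul_one]
          _ ≤ ∫⁻ z in whitneyRegion c₀ (c₁ / c₀) w, C * ((volume (whitneyRegion c₀ c₁ z))⁻¹ *
              {x : Space n × Space n | x.2 ∈ whitneyRegion c₀ c₁ x.1}.indicator
                (fun x => h x.2) (z, w)) :=
              setLIntegral_mono' (measurableSet_whitneyRegion hc₀ w) hpt
          _ ≤ ∫⁻ z in halfSpace n, C * ((volume (whitneyRegion c₀ c₁ z))⁻¹ *
              {x : Space n × Space n | x.2 ∈ whitneyRegion c₀ c₁ x.1}.indicator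
                (fun x => h x.2) (z, w)) := lintegral_mono_set fun z hz => hz.1
          _ = _ := lintegral_const_mul' _ _ ENNReal.coe_ne_top
    _ = C * ∫⁻ w in halfSpace n, ∫⁻ z in halfSpace n, (volume (whitneyRegion c₀ c₁ z))⁻¹ *
        {x : Space n × Space n | x.2 ∈ whitneyRegion c₀ c₁ x.1}.indicator (fun x => h x.2) (z, w) :=
        lintegral_const_mul' _ _ ENNReal.coe_ne_top
    _ = C * ∫⁻ z in halfSpace n, ∫⁻ w in halfSpace n, (volume (whitneyRegion c₀ c₁ z))⁻¹ *
        {x : Space n × Space n | x.2 ∈ whitneyRegion c₀ c₁ x.1}.indicator (fun x => h x.2) (z, w) := by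
        congr 1
        exact (lintegral_lintegral_swap hmS.aemeasurable).symm
    _ ≤ _ := by
        gcongr with z
        have hm : Measurable ((whitneyRegion c₀ c₁ z).indicator h) :=
          hh.indicator (measurableSet_whitneyRegion hc₀ z)
        rw [← lintegral_indicator (measurableSet_whitneyRegion hc₀ z), ← lintegral_const_mul _ hm]
        exact setLIntegral_le_lintegral _ _

end Geometry

/-! ### The Carleson embedding -/

section Embedding

variable {n : ℕ} {c₀ c₁ : ℝ}

lemma le_nontangentialMax {a : ℝ} (F : Space n → ℝ≥0∞) {z : Space n} (hz : 0 < z.1)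
    {y : EuclideanSpace ℝ (Fin n)} (hy : ‖z.2 - y‖ ≤ a * z.1) : F z ≤ nontangentialMax a F y :=
  le_iSup₂_of_le (f := fun (z : Space n) (_ : z ∈ halfSpace n ∧ ‖z.2 - y‖ ≤ a * z.1) => F z)
    z ⟨hz, hy⟩ le_rfl

/-- If the set `O` contains the shadow of every point of `E`, then the mass of `G` on `E` is
controlled by the integral over `O` of the Carleson functional of `G`: the shadows of a Vitali
subfamily are disjoint subsets of `O`, and the Carleson boxes over their dilates cover `E`. -/
lemma exists_setLIntegral_le_carlesonFunctional (n : ℕ) {a : ℝ} (ha : 0 < a) :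
    ∃ K : ℝ≥0, ∀ (G : Space n → ℝ≥0∞) (E : Set (Space n)) (O : Set (EuclideanSpace ℝ (Fin n))),
      E ⊆ halfSpace n → (∀ z ∈ E, closedBall z.2 (a * z.1) ⊆ O) →
      ∫⁻ z in E, G z ≤ K * ∫⁻ y in O, carlesonFunctional 1 G y := by
  set c : ℝ := 3 * a + 2 with hc
  have hc0 : 0 < c := by positivity
  refine ⟨((n + 1) / (a / (2 * c))).toNNReal ^ n, fun G E O hE hO => ?_⟩
  -- heights are truncated at `m` so that the covering lemma applies
  let A : ℕ → Set (Space n) := fun m => {z ∈ E | z.1 ≤ m}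
  have hAE : E = ⋃ m, A m := by
    ext z
    simp only [A, mem_iUnion, mem_ofPred_eq, exists_and_left]
    exact ⟨fun h => ⟨h, exists_nat_ge z.1⟩, fun h => h.1⟩
  have hdir : Directed (· ⊆ ·) A := by
    refine Monotone.directed_le (f := A) ?_
    rintro j m hjm z ⟨hz, hzj⟩
    exact ⟨hz, hzj.trans (by exact_mod_cast hjm)⟩
  rw [hAE, setLIntegral_iUnion_of_directed _ hdir]
  refine iSup_le fun m => ?_
  obtain ⟨u, hut, hdisj, hcov⟩ := Vitali.exists_disjoint_subfamily_covering_enlargement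
    (fun z : Space n => closedBall z.2 (a * z.1)) (A m) (fun z => z.1) 2 one_lt_two
    (fun z hz => (show 0 < z.1 from hE hz.1).le) m (fun z hz => hz.2)
    (fun z hz => ⟨z.2, mem_closedBall_self (mul_nonneg ha.le (show 0 < z.1 from hE hz.1).le)⟩)
  have hupos : ∀ z ∈ u, 0 < z.1 := fun z hz => hE (hut hz).1
  have hcount : u.Countable := hdisj.countable_of_nonempty_interior fun z hz =>
    ⟨z.2, ball_subset_interior_closedBall (mem_ball_self (mul_pos ha (hupos z hz)))⟩
  let box : Space n → Set (Space n) := fun z => carlesonBox (cubeCorner z.2 (c * z.1)) (2 * (c * z.1))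
  have hsub : A m ⊆ ⋃ z ∈ u, box z := by
    intro z hz
    obtain ⟨b, hb, ⟨y, hy1, hy2⟩, hzb⟩ := hcov z hz
    have hz0 : 0 < z.1 := hE hz.1
    have hb0 := hupos b hb
    simp only [mem_closedBall] at hy1 hy2
    have h3 : a * z.1 ≤ a * (2 * b.1) := by gcongr
    refine mem_iUnion₂.2 ⟨b, hb, ⟨hz0, ?_⟩, ball_subset_cube _ _ ?_⟩
    · show z.1 < 2 * (c * b.1)
      nlinarith [mul_pos ha hb0]
    · rw [mem_ball]
      have := dist_triangle z.2 y b.2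
      rw [dist_comm] at hy1
      nlinarith
  have hbox : ∀ z ∈ u, ∫⁻ w in box z, G w ≤ (((n + 1) / (a / (2 * c))).toNNReal ^ n : ℝ≥0) *
      ∫⁻ y in closedBall z.2 (a * z.1), carlesonFunctional 1 G y := by
    intro z hz
    have hz0 := hupos z hz
    have hR : 0 < a * z.1 := by positivity
    have hV := volume_cube_le_volume_ball z.2 (cubeCorner z.2 (c * z.1)) (c := a / (2 * c))
      (l := 2 * (c * z.1)) (by positivity) (by positivity)
    rw [show a / (2 * c) * (2 * (c * z.1)) = a * z.1 by field_simp] at hV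
    calc ∫⁻ w in box z, G w = ∫⁻ y in ball z.2 (a * z.1),
          (volume (ball z.2 (a * z.1)))⁻¹ * ∫⁻ w in box z, G w := by
          rw [setLIntegral_const, mul_assoc, mul_comm, mul_assoc,
            ENNReal.mul_inv_cancel (volume_ball_ne_zero _ hR) (volume_ball_ne_top _ _), mul_one]
      _ ≤ ∫⁻ y in ball z.2 (a * z.1), (((n + 1) / (a / (2 * c))).toNNReal ^ n : ℝ≥0) *
          carlesonFunctional 1 G y := by
          refine setLIntegral_mono' measurableSet_ball fun y hy => ?_
          rw [ENNReal.inv_mul_le_iff (volume_ball_ne_zero _ hR) (volume_ball_ne_top _ _)]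
          refine (setLIntegral_carlesonBox_le G (by positivity) (ball_subset_cube _ _
            (ball_subset_ball ?_ hy))).trans ?_
          · nlinarith
          · refine (mul_le_mul_left hV _).trans (le_of_eq ?_)
            simp only [ENNReal.ofReal]
            push_cast
            ring
      _ = _ := lintegral_const_mul' _ _ ENNReal.coe_ne_top
      _ ≤ _ := by
          gcongr
          exact ball_subset_closedBall
  calc ∫⁻ z in A m, G z ≤ ∫⁻ z in ⋃ z ∈ u, box z, G z := lintegral_mono_set hsub
    _ ≤ ∑' z : u, ∫⁻ w in box z, G w := by
        have := hcount.to_subtype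
        rw [biUnion_eq_iUnion]
        exact lintegral_iUnion_le _ _
    _ ≤ ∑' z : u, (((n + 1) / (a / (2 * c))).toNNReal ^ n : ℝ≥0) *
        ∫⁻ y in closedBall z.1.2 (a * z.1.1), carlesonFunctional 1 G y :=
        ENNReal.tsum_le_tsum fun z => hbox z.1 z.2
    _ = (((n + 1) / (a / (2 * c))).toNNReal ^ n : ℝ≥0) *
        ∫⁻ y in ⋃ z ∈ u, closedBall z.2 (a * z.1), carlesonFunctional 1 G y := by
        rw [ENNReal.tsum_mul_left, lintegral_biUnion hcount (fun _ _ => measurableSet_closedBall) hdisj]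
    _ ≤ _ := by
        gcongr
        exact iUnion₂_subset fun z hz => hO z (hAE ▸ mem_iUnion.2 ⟨m, hut hz⟩)

/-- Carleson's inequality: integrate the estimate for level sets over all heights. -/
lemma exists_lintegral_mul_le_nontangentialMax_mul (n : ℕ) {a : ℝ} (ha : 0 < a) :
    ∃ K : ℝ≥0, ∀ F G : Space n → ℝ≥0∞, LowerSemicontinuous F → Measurable G →
      ∫⁻ z in halfSpace n, F z * G z ≤
        K * ∫⁻ y, nontangentialMax a F y * carlesonFunctional 1 G y := by
  obtain ⟨K, hK⟩ := exists_setLIntegral_le_carlesonFunctional n ha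
  refine ⟨K, fun F G hF hG => ?_⟩
  have hN := measurable_nontangentialMax a ha hF
  have h1 := lintegral_rpow_mul_eq_layer (μ := volume.restrict (halfSpace n)) one_pos
    hF.measurable hG
  have h2 := lintegral_rpow_mul_eq_layer (μ := volume) one_pos hN
    (measurable_carlesonFunctional 1 G)
  simp only [ENNReal.rpow_one] at h1 h2
  rw [h1, h2, ← lintegral_const_mul' _ _ ENNReal.coe_ne_top]
  refine lintegral_mono fun t => ?_
  rw [mul_left_comm, Measure.restrict_restrict (measurableSet_lt measurable_const hF.measurable)]
  refine mul_le_mul_right (hK G _ _ inter_subset_right ?_) _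
  rintro z ⟨hz1, hz2⟩ y hy
  refine lt_of_lt_of_le hz1 (le_nontangentialMax F hz2 ?_)
  rwa [mem_closedBall, dist_comm, dist_eq_norm] at hy

lemma one_div_toReal_add_one_div_toReal {q q' : ℝ≥0∞} [ENNReal.HolderConjugate q q'] :
    (1 / q).toReal + (1 / q').toReal = 1 := by
  have h := ENNReal.HolderConjugate.inv_add_inv_eq_one q q'
  have h0 := ENNReal.HolderConjugate.ne_zero q q'
  have h0' := ENNReal.HolderConjugate.ne_zero q' q
  rw [one_div, one_div, ← ENNReal.toReal_add (by simpa) (by simpa), h, ENNReal.toReal_one]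

/-- Hölder's inequality for Whitney averages. -/
lemma average_mul_le_whitneyMean_mul (hc₀ : 1 < c₀) (hc₁ : 0 < c₁) {q q' : ℝ≥0∞}
    [ENNReal.HolderConjugate q q'] {u v : Space n → ℝ≥0∞} (hu : Measurable u) (hv : Measurable v)
    {z : Space n} (hz : 0 < z.1) :
    (volume (whitneyRegion c₀ c₁ z))⁻¹ * ∫⁻ w in whitneyRegion c₀ c₁ z, u w * v w ≤
      whitneyMean c₀ c₁ q u z * whitneyMean c₀ c₁ q' v z := by
  have h0 := volume_whitneyRegion_ne_zero hc₀ hc₁ hz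
  have ht := volume_whitneyRegion_ne_top hc₀ hc₁ z
  unfold whitneyMean
  rw [mul_mul_mul_comm, ← ENNReal.rpow_add _ _ h0 ht, ← neg_add,
    one_div_toReal_add_one_div_toReal, ENNReal.rpow_neg_one]
  gcongr
  exact lintegral_mul_le_eLpNorm_mul hu.aemeasurable hv.aemeasurable

/-- The product estimate, for nonnegative functions and `r = 1`. -/
theorem exists_lintegral_mul_le (n : ℕ) {a : ℝ} (ha : 0 < a) (hc₀ : 1 < c₀) (hc₁ : 0 < c₁)
    {p p' q q' : ℝ≥0∞} [ENNReal.HolderConjugate p p'] [ENNReal.HolderConjugate q q'] :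
    ∃ K : ℝ≥0, ∀ u v : Space n → ℝ≥0∞, Measurable u → Measurable v →
      ∫⁻ z in halfSpace n, u z * v z ≤
        K * eLpNorm (nontangentialMax a (whitneyMean c₀ c₁ q u)) p volume *
          eLpNorm (carlesonFunctional 1 (whitneyMean c₀ c₁ q' v)) p' volume := by
  obtain ⟨K₁, hK₁⟩ := exists_lintegral_le_lintegral_average n hc₀ hc₁
  obtain ⟨K₂, hK₂⟩ := exists_lintegral_mul_le_nontangentialMax_mul n ha
  refine ⟨K₁ * K₂, fun u v hu hv => ?_⟩
  have hq := ENNReal.HolderConjugate.ne_zero q q'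
  have hq' := ENNReal.HolderConjugate.ne_zero q' q
  have hF := lowerSemicontinuous_whitneyMean hc₀ hc₁ hq hu
  calc ∫⁻ z in halfSpace n, u z * v z
      ≤ K₁ * ∫⁻ z in halfSpace n,
        (volume (whitneyRegion c₀ c₁ z))⁻¹ * ∫⁻ w in whitneyRegion c₀ c₁ z, u w * v w :=
        hK₁ _ (hu.mul hv)
    _ ≤ K₁ * ∫⁻ z in halfSpace n, whitneyMean c₀ c₁ q u z * whitneyMean c₀ c₁ q' v z := by
        refine mul_le_mul_right (setLIntegral_mono' measurableSet_halfSpace fun z hz => ?_) _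
        exact average_mul_le_whitneyMean_mul hc₀ hc₁ hu hv hz
    _ ≤ K₁ * (K₂ * (eLpNorm (nontangentialMax a (whitneyMean c₀ c₁ q u)) p volume *
          eLpNorm (carlesonFunctional 1 (whitneyMean c₀ c₁ q' v)) p' volume)) := by
        gcongr
        refine (hK₂ _ _ hF (measurable_whitneyMean hc₀ hc₁ hq' hv)).trans ?_
        gcongr
        exact lintegral_mul_le_eLpNorm_mul (measurable_nontangentialMax a ha hF).aemeasurable
          (measurable_carlesonFunctional 1 _).aemeasurable
    _ = _ := by push_cast; ring

end Embedding

/-! ### Superpositions of extremal functions on Whitney regions -/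

section Synthesis

variable {n : ℕ} {c₀ c₁ : ℝ}

/-- A near-extremal function for the duality of `L_q` and `L_{q'}` on one Whitney region. -/
lemma exists_whitneyMean_dual (hc₀ : 1 < c₀) (hc₁ : 0 < c₁) {q q' : ℝ≥0∞}
    [ENNReal.HolderConjugate q q'] {u : Space n → ℝ≥0∞} (hu : Measurable u) {z : Space n}
    (hz : 0 < z.1) {l : ℝ≥0∞} (hl : l = 0 ∨ l < whitneyMean c₀ c₁ q u z) :
    ∃ v : Space n → ℝ≥0, Measurable v ∧ (∀ w ∉ whitneyRegion c₀ c₁ z, v w = 0) ∧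
      l ≤ ∫⁻ w in halfSpace n, u w * v w ∧
      eLpNorm (fun w => (v w : ℝ≥0∞)) q' volume ≤
        volume (whitneyRegion c₀ c₁ z) ^ (-(1 / q).toReal) := by
  rcases hl with rfl | hl
  · exact ⟨0, measurable_zero, by simp, by simp, by simp⟩
  have hW := measurableSet_whitneyRegion (c₁ := c₁) hc₀ z
  have h0 := volume_whitneyRegion_ne_zero hc₀ hc₁ hz
  have ht := volume_whitneyRegion_ne_top hc₀ hc₁ z
  set W := whitneyRegion c₀ c₁ z
  set e := volume W ^ (-(1 / q).toReal) with he
  have he0 : e ≠ 0 := by simp [he, ENNReal.rpow_eq_zero_iff, h0, ht]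
  have het : e ≠ ∞ := by simp [he, ENNReal.rpow_eq_top_iff, h0, ht]
  have hl' : e⁻¹ * l < eLpNorm u q (volume.restrict W) := by
    rw [mul_comm, ← div_eq_mul_inv]
    refine ENNReal.div_lt_of_lt_mul ?_
    rw [mul_comm]; exact hl
  obtain ⟨v, hv, hv1, -, hlv⟩ := exists_lt_lintegral_mul (q := q') hu hl'
  have hve : ∀ w, ((e.toNNReal * W.indicator v w : ℝ≥0) : ℝ≥0∞) =
      e * W.indicator (fun w => (v w : ℝ≥0∞)) w := by
    intro w
    rw [ENNReal.coe_mul, ENNReal.coe_toNNReal het, ENNReal.coe_indicator]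
  refine ⟨fun w => e.toNNReal * W.indicator v w, (hv.indicator hW).const_mul _, ?_, ?_, ?_⟩
  · intro w hw
    simp [hw]
  · calc l = e * (e⁻¹ * l) := by rw [← mul_assoc, ENNReal.mul_inv_cancel he0 het, one_mul]
      _ ≤ e * ∫⁻ w in W, u w * v w := by gcongr
      _ = e * ∫⁻ w in W, u w * W.indicator (fun w => (v w : ℝ≥0∞)) w := by
          congr 1
          refine setLIntegral_congr_fun hW fun w hw => ?_
          simp [hw]
      _ ≤ e * ∫⁻ w in halfSpace n, u w * W.indicator (fun w => (v w : ℝ≥0∞)) w := by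
          gcongr
          exact fun w hw => hw.1
      _ = _ := by
          rw [← lintegral_const_mul' _ _ het]
          refine lintegral_congr fun w => ?_
          rw [hve, mul_left_comm]
  · calc eLpNorm (fun w => ((e.toNNReal * W.indicator v w : ℝ≥0) : ℝ≥0∞)) q' volume
        ≤ e.toNNReal * eLpNorm (W.indicator fun w => (v w : ℝ≥0∞)) q' volume := by
          simp_rw [ENNReal.coe_mul, ENNReal.coe_indicator]
          exact eLpNorm_const_mul_le q' _ _
      _ ≤ e := by
          rw [ENNReal.coe_toNNReal het, eLpNorm_indicator_eq_eLpNorm_restrict hW]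
          exact mul_le_of_le_one_right' hv1

lemma mem_whitneyRegion_of_inter_nonempty (hc₀ : 1 < c₀) (hc₁ : 0 < c₁) {z w : Space n}
    (h : (whitneyRegion c₀ c₁ z ∩ whitneyRegion c₀ c₁ w).Nonempty) :
    w ∈ whitneyRegion (c₀ ^ 2) (c₁ * (1 + c₀ ^ 2)) z := by
  have hc : 0 < c₀ := by linarith
  obtain ⟨x, hxz, hxw⟩ := h
  rw [mem_whitneyRegion_iff hc₀] at hxz hxw
  rw [mem_whitneyRegion_iff (by nlinarith)]
  obtain ⟨h1, h2, h3, h4, h5⟩ := hxz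
  obtain ⟨-, k2, k3, k4, k5⟩ := hxw
  have hwz : w.1 < c₀ ^ 2 * z.1 := by nlinarith
  refine ⟨k2, h2, ?_, by nlinarith, hwz⟩
  have := norm_sub_le_norm_sub_add_norm_sub w.2 x.2 z.2
  rw [norm_sub_rev w.2 x.2] at this
  nlinarith

/-- Finite superpositions of near-extremal functions: a finite combination of values below the
Whitney averages of `u` is realized by pairing `u` with a function whose conjugate Whitney averages
are governed by the coefficients of the nearby points. -/
lemma exists_superposition (n : ℕ) (hc₀ : 1 < c₀) (hc₁ : 0 < c₁) {q q' : ℝ≥0∞}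
    [ENNReal.HolderConjugate q q'] :
    ∃ C : ℝ≥0, ∀ (s : Finset ℕ) (z : ℕ → Space n) (m : ℕ → ℝ≥0) (l : ℕ → ℝ≥0∞)
      (u : Space n → ℝ≥0∞), Measurable u → (∀ k ∈ s, 0 < (z k).1) →
      (∀ k ∈ s, l k = 0 ∨ l k < whitneyMean c₀ c₁ q u (z k)) →
      ∃ v : Space n → ℝ≥0, Measurable v ∧
        ∑ k ∈ s, m k * l k ≤ ∫⁻ w in halfSpace n, u w * v w ∧
        ∀ w, 0 < w.1 → whitneyMean c₀ c₁ q' (fun w => (v w : ℝ≥0∞)) w ≤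
          C * ∑ k ∈ s, (whitneyRegion (c₀ ^ 2) (c₁ * (1 + c₀ ^ 2)) (z k)).indicator
            (fun _ => m k * (volume (whitneyRegion c₀ c₁ (z k)))⁻¹) w := by
  have hc : 0 < c₀ := by linarith
  obtain ⟨C, hC⟩ := exists_volume_whitneyRegion_le n hc₀ hc₁ hc₀ hc₁ (sq_nonneg c₀)
  refine ⟨C ^ (1 / q').toReal, fun s z m l u hu hz hl => ?_⟩
  choose! v hv hvW hlv hvn using fun k (hk : k ∈ s) =>
    exists_whitneyMean_dual (q' := q') hc₀ hc₁ hu (hz k hk) (hl k hk)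
  have hmv : ∀ k ∈ s, Measurable fun w => (m k : ℝ≥0∞) * v k w := fun k hk =>
    (hv k hk).coe_nnreal_ennreal.const_mul _
  refine ⟨fun w => ∑ k ∈ s, m k * v k w,
    Finset.measurable_fun_sum _ fun k hk => (hv k hk).const_mul _, ?_, fun w hw => ?_⟩
  · calc ∑ k ∈ s, m k * l k ≤ ∑ k ∈ s, m k * ∫⁻ w in halfSpace n, u w * v k w := by
          gcongr with k hk
          exact hlv k hk
      _ = ∑ k ∈ s, ∫⁻ w in halfSpace n, u w * (m k * v k w) := by
          refine Finset.sum_congr rfl fun k _ => ?_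
          rw [← lintegral_const_mul' _ _ ENNReal.coe_ne_top]
          simp_rw [mul_left_comm]
      _ = _ := by
          rw [← lintegral_finsetSum' (f := fun k w => u w * (m k * v k w)) s
            fun k hk => (hu.mul (hmv k hk)).aemeasurable]
          push_cast
          simp_rw [Finset.mul_sum]
  · have hWw0 := volume_whitneyRegion_ne_zero hc₀ hc₁ hw
    have hWwt := volume_whitneyRegion_ne_top hc₀ hc₁ w
    have hone := one_div_toReal_add_one_div_toReal (q := q) (q' := q')
    have hterm : ∀ k ∈ s, volume (whitneyRegion c₀ c₁ w) ^ (-(1 / q').toReal) *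
        eLpNorm (fun x => (m k : ℝ≥0∞) * v k x) q' (volume.restrict (whitneyRegion c₀ c₁ w)) ≤
        (C ^ (1 / q').toReal : ℝ≥0) *
          (whitneyRegion (c₀ ^ 2) (c₁ * (1 + c₀ ^ 2)) (z k)).indicator
            (fun _ => m k * (volume (whitneyRegion c₀ c₁ (z k)))⁻¹) w := by
      intro k hk
      by_cases hmeet : (whitneyRegion c₀ c₁ (z k) ∩ whitneyRegion c₀ c₁ w).Nonempty
      · rw [indicator_of_mem (mem_whitneyRegion_of_inter_nonempty hc₀ hc₁ hmeet)]
        have hz0 := volume_whitneyRegion_ne_zero hc₀ hc₁ (hz k hk)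
        have hzt := volume_whitneyRegion_ne_top hc₀ hc₁ (z k)
        obtain ⟨x, hx1, hx2⟩ := hmeet
        rw [mem_whitneyRegion_iff hc₀] at hx1 hx2
        have hle : volume (whitneyRegion c₀ c₁ (z k)) ≤ C * volume (whitneyRegion c₀ c₁ w) :=
          hC _ _ (by nlinarith)
        have hpow : volume (whitneyRegion c₀ c₁ w) ^ (-(1 / q').toReal) ≤
            (C ^ (1 / q').toReal : ℝ≥0) *
              volume (whitneyRegion c₀ c₁ (z k)) ^ (-(1 / q').toReal) := by
          rw [ENNReal.rpow_neg, ENNReal.rpow_neg, ENNReal.coe_rpow_of_nonneg _ ENNReal.toReal_nonneg,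
            ← ENNReal.div_eq_inv_mul.trans (mul_comm _ _)]
          rw [ENNReal.le_div_iff_mul_le
            (Or.inl (by simp [ENNReal.rpow_eq_zero_iff, hz0, hzt]))
            (Or.inl (by simp [ENNReal.rpow_eq_top_iff, hz0, hzt])),
            ENNReal.inv_mul_le_iff (by simp [ENNReal.rpow_eq_zero_iff, hWw0, hWwt])
              (by simp [ENNReal.rpow_eq_top_iff, hWw0, hWwt]), mul_comm,
            ← ENNReal.mul_rpow_of_nonneg _ _ ENNReal.toReal_nonneg]
          gcongr
        calc _ ≤ ((C ^ (1 / q').toReal : ℝ≥0) *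
              volume (whitneyRegion c₀ c₁ (z k)) ^ (-(1 / q').toReal)) *
              (m k * volume (whitneyRegion c₀ c₁ (z k)) ^ (-(1 / q).toReal)) := by
              gcongr
              refine (eLpNorm_const_mul_le q' _ _).trans ?_
              gcongr
              exact (eLpNorm_mono_measure _ Measure.restrict_le_self).trans (hvn k hk)
          _ = (C ^ (1 / q').toReal : ℝ≥0) * (m k *
              (volume (whitneyRegion c₀ c₁ (z k)) ^ (-(1 / q).toReal) *
                volume (whitneyRegion c₀ c₁ (z k)) ^ (-(1 / q').toReal))) := by ring
          _ = _ := by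
              rw [← ENNReal.rpow_add _ _ hz0 hzt, ← neg_add, hone, ENNReal.rpow_neg_one]
      · have : eLpNorm (fun x => (m k : ℝ≥0∞) * v k x) q'
            (volume.restrict (whitneyRegion c₀ c₁ w)) = 0 := by
          rw [← eLpNorm_zero (μ := volume.restrict (whitneyRegion c₀ c₁ w)) (p := q')
            (α := Space n) (ε := ℝ≥0∞)]
          refine eLpNorm_congr_ae ?_
          filter_upwards [ae_restrict_mem (measurableSet_whitneyRegion hc₀ w)] with x hx
          have : x ∉ whitneyRegion c₀ c₁ (z k) := fun h => hmeet ⟨x, h, hx⟩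
          simp [hvW k hk x this]
        rw [this, mul_zero]
        exact zero_le
    rw [Finset.mul_sum]
    refine le_trans ?_ (Finset.sum_le_sum hterm)
    rw [← Finset.mul_sum, whitneyMean]
    gcongr
    refine le_trans (le_of_eq ?_) (eLpNorm_sum_le (f := fun k x => (m k : ℝ≥0∞) * v k x)
      (fun k hk => (hmv k hk).aestronglyMeasurable) (ENNReal.HolderConjugate.one_le q' q))
    congr 1
    ext x
    simp

end Synthesis

/-! ### The non-tangential norm as a supremum of pairings -/

section Nontangential

variable {n : ℕ} {c₀ c₁ : ℝ}

lemma exists_dense_seq_halfSpace (n : ℕ) : ∃ d : ℕ → Space n, (∀ k, 0 < (d k).1) ∧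
    ∀ O : Set (Space n), IsOpen O → (O ∩ halfSpace n).Nonempty → ∃ k, d k ∈ O := by
  classical
  refine ⟨fun k => if 0 < (TopologicalSpace.denseSeq (Space n) k).1 then
    TopologicalSpace.denseSeq (Space n) k else (1, 0), fun k => ?_, fun O hO hne => ?_⟩
  · dsimp only
    split_ifs with h
    · exact h
    · exact one_pos
  · have hhalf : IsOpen (halfSpace n) := isOpen_lt continuous_const continuous_fst
    obtain ⟨x, hx, k, rfl⟩ := (TopologicalSpace.denseRange_denseSeq (Space n)).inter_open_nonempty
      _ (hO.inter hhalf) hne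
    refine ⟨k, ?_⟩
    have hpos : 0 < (TopologicalSpace.denseSeq (Space n) k).1 := hx.2
    simpa only [if_pos hpos] using hx.1

lemma iSup_min_natCast (x : ℝ≥0∞) : ⨆ m : ℕ, min x m = x := by
  have h := inf_iSup_eq x (fun m : ℕ => (m : ℝ≥0∞))
  rw [ENNReal.iSup_natCast, inf_top_eq] at h
  exact h.symm

lemma measurable_range_sup {α : Type*} [MeasurableSpace α] {f : ℕ → α → ℝ≥0∞}
    (hf : ∀ k, Measurable (f k)) (m : ℕ) :
    Measurable fun x => (Finset.range m).sup fun k => f k x := by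
  simp_rw [Finset.sup_eq_iSup]
  exact Measurable.biSup _ (to_countable _) fun k _ => hf k

/-- The integral of a finite maximum splits into integrals of the competitors over disjoint sets. -/
lemma exists_lintegral_sup_mul_le {α : Type*} [MeasurableSpace α] (μ : Measure α)
    {f : ℕ → α → ℝ≥0∞} (hf : ∀ k, Measurable (f k)) (m : ℕ) :
    ∃ E : ℕ → Set α, (∀ k, MeasurableSet (E k)) ∧ Pairwise (Function.onFun Disjoint E) ∧
      ∀ w : α → ℝ≥0∞, ∫⁻ x, ((Finset.range m).sup fun k => f k x) * w x ∂μ ≤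
        ∑ k ∈ Finset.range m, ∫⁻ x in E k, f k x * w x ∂μ := by
  let N : α → ℝ≥0∞ := fun x => (Finset.range m).sup fun k => f k x
  have hN : Measurable N := measurable_range_sup hf m
  let E : ℕ → Set α := fun k => {x | N x ≤ f k x}
  have hE : ∀ k, MeasurableSet (E k) := fun k => measurableSet_le hN (hf k)
  refine ⟨disjointed E, fun k => MeasurableSet.disjointed hE k, disjoint_disjointed E, fun w => ?_⟩
  rcases Nat.eq_zero_or_pos m with rfl | hm
  · simp
  have hcov : (⋃ k ∈ Finset.range m, disjointed E k) = univ := by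
    rw [eq_univ_iff_forall]
    intro x
    obtain ⟨k, hk, hkx⟩ := Finset.exists_mem_eq_sup (Finset.range m)
      (Finset.nonempty_range_iff.2 hm.ne') fun k => f k x
    have hx : x ∈ partialSups E k := by
      rw [partialSups_apply]
      exact (Finset.le_sup' E (by simp : k ∈ Finset.Iic k)) (show N x ≤ f k x from hkx.le)
    rw [← partialSups_disjointed, partialSups_eq_biSup] at hx
    simp only [iSup_eq_iUnion, mem_iUnion] at hx ⊢
    obtain ⟨j, hj, hxj⟩ := hx
    exact ⟨j, Finset.mem_range.2 (hj.trans_lt (Finset.mem_range.1 hk)), hxj⟩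
  calc ∫⁻ x, N x * w x ∂μ = ∫⁻ x in ⋃ k ∈ Finset.range m, disjointed E k, N x * w x ∂μ := by
        rw [hcov, Measure.restrict_univ]
    _ = ∑ k ∈ Finset.range m, ∫⁻ x in disjointed E k, N x * w x ∂μ :=
        lintegral_biUnion_finset (fun i _ j _ hij => disjoint_disjointed E hij)
          (fun k _ => MeasurableSet.disjointed hE k) _
    _ ≤ _ := by
        refine Finset.sum_le_sum fun k _ => ?_
        refine setLIntegral_mono' (MeasurableSet.disjointed hE k) fun x hx => ?_
        exact mul_le_mul_left (disjointed_subset E k hx) _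

/-- A point mass distribution on the half space whose masses are integrals of `h` over disjoint
subsets of the shadows of the points, smeared out over Whitney regions, has Carleson functional
controlled by the maximal function of `h`. -/
lemma exists_carlesonFunctional_le_maximalFunction (n : ℕ) {a : ℝ} (ha : 0 < a) (hc₀ : 1 < c₀)
    (hc₁ : 0 < c₁) :
    ∃ K : ℝ≥0, ∀ (s : Finset ℕ) (z : ℕ → Space n) (m : ℕ → ℝ≥0)
      (E : ℕ → Set (EuclideanSpace ℝ (Fin n))) (h : EuclideanSpace ℝ (Fin n) → ℝ≥0∞)
      (G : Space n → ℝ≥0∞),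
      (∀ k ∈ s, 0 < (z k).1) → (∀ k, MeasurableSet (E k)) →
      Pairwise (Function.onFun Disjoint E) → (∀ k ∈ s, E k ⊆ closedBall (z k).2 (a * (z k).1)) →
      (∀ k ∈ s, (m k : ℝ≥0∞) ≤ ∫⁻ y in E k, h y) →
      (∀ w, 0 < w.1 → G w ≤ ∑ k ∈ s,
        (whitneyRegion (c₀ ^ 2) (c₁ * (1 + c₀ ^ 2)) (z k)).indicator
          (fun _ => m k * (volume (whitneyRegion c₀ c₁ (z k)))⁻¹) w) →
      ∀ x, carlesonFunctional 1 G x ≤ K * maximalFunction h x := by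
  classical
  have hc : 0 < c₀ := by linarith
  have hd₀ : 1 < c₀ ^ 2 := by nlinarith
  have hd₁ : 0 < c₁ * (1 + c₀ ^ 2) := by positivity
  obtain ⟨C, hC⟩ := exists_volume_whitneyRegion_le n hd₀ hd₁ hc₀ hc₁ zero_le_one
  set R : ℝ := a * c₀ ^ 2 + c₁ * (1 + c₀ ^ 2) * c₀ ^ 2 + n with hR
  have hR0 : 0 < R := by positivity
  refine ⟨C * (2 * R).toNNReal ^ n, fun s z m E h G hz hE hdisj hEB hm hG x => ?_⟩
  refine carlesonFunctional_one_le fun b l hl hx => ?_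
  let T : ℕ → Set (Space n) := fun k => whitneyRegion (c₀ ^ 2) (c₁ * (1 + c₀ ^ 2)) (z k)
  have hT : ∀ k, MeasurableSet (T k) := fun k => measurableSet_whitneyRegion hd₀ _
  let s' : Finset ℕ := s.filter fun k => (T k ∩ carlesonBox b l).Nonempty
  have hterm : ∀ k ∈ s, ∫⁻ w in carlesonBox b l,
      (T k).indicator (fun _ => m k * (volume (whitneyRegion c₀ c₁ (z k)))⁻¹) w ≤
        if (T k ∩ carlesonBox b l).Nonempty then C * ∫⁻ y in E k, h y else 0 := by
    intro k hk
    have h0 := volume_whitneyRegion_ne_zero hc₀ hc₁ (hz k hk)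
    have ht := volume_whitneyRegion_ne_top hc₀ hc₁ (z k)
    rw [setLIntegral_indicator (hT k), setLIntegral_const]
    split_ifs with hne
    · calc m k * (volume (whitneyRegion c₀ c₁ (z k)))⁻¹ * volume (T k ∩ carlesonBox b l)
          ≤ (∫⁻ y in E k, h y) * (volume (whitneyRegion c₀ c₁ (z k)))⁻¹ *
            (C * volume (whitneyRegion c₀ c₁ (z k))) := by
            gcongr
            · exact hm k hk
            · exact (measure_mono inter_subset_left).trans (hC _ _ (by simp))
        _ = C * (∫⁻ y in E k, h y) * ((volume (whitneyRegion c₀ c₁ (z k)))⁻¹ *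
            volume (whitneyRegion c₀ c₁ (z k))) := by ring
        _ = _ := by rw [ENNReal.inv_mul_cancel h0 ht, mul_one]
    · rw [not_nonempty_iff_eq_empty] at hne
      simp [hne]
  have hsub : ∀ k ∈ s', E k ⊆ ball x (R * l) := by
    intro k hk y hy
    obtain ⟨hks, w, hw, hwb⟩ := Finset.mem_filter.1 hk
    have hy' := hEB k hks hy
    rw [mem_whitneyRegion_iff hd₀] at hw
    obtain ⟨h1, h2, h3, h4, h5⟩ := hw
    rw [mem_closedBall] at hy'
    rw [mem_ball]
    have hwl : w.1 < l := hwb.1.2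
    have hzl : (z k).1 < c₀ ^ 2 * l := by nlinarith
    have e1 := dist_le_of_mem_cube hwb.2 hx
    have e2 := dist_triangle y (z k).2 w.2
    have e3 := dist_triangle y w.2 x
    rw [← dist_eq_norm, dist_comm] at h3
    have e4 : a * (z k).1 < a * (c₀ ^ 2 * l) := by gcongr
    have e5 : c₁ * (1 + c₀ ^ 2) * (z k).1 < c₁ * (1 + c₀ ^ 2) * (c₀ ^ 2 * l) := by gcongr
    calc dist y x < a * (c₀ ^ 2 * l) + c₁ * (1 + c₀ ^ 2) * (c₀ ^ 2 * l) + n * l := by linarith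
      _ = R * l := by rw [hR]; ring
  calc ∫⁻ w in carlesonBox b l, G w
      ≤ ∫⁻ w in carlesonBox b l, ∑ k ∈ s, (T k).indicator
        (fun _ => m k * (volume (whitneyRegion c₀ c₁ (z k)))⁻¹) w :=
        setLIntegral_mono' (measurableSet_carlesonBox b l) fun w hw => hG w hw.1.1
    _ = ∑ k ∈ s, ∫⁻ w in carlesonBox b l, (T k).indicator
        (fun _ => m k * (volume (whitneyRegion c₀ c₁ (z k)))⁻¹) w :=
        lintegral_finsetSum _ fun k _ => measurable_const.indicator (hT k)
    _ ≤ ∑ k ∈ s, if (T k ∩ carlesonBox b l).Nonempty then C * ∫⁻ y in E k, h y else 0 :=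
        Finset.sum_le_sum hterm
    _ = C * ∫⁻ y in ⋃ k ∈ s', E k, h y := by
        rw [← Finset.sum_filter, ← Finset.mul_sum,
          lintegral_biUnion_finset (fun i _ j _ hij => hdisj hij) fun k _ => hE k]
    _ ≤ C * ∫⁻ y in ball x (R * l), h y := by
        gcongr
        exact iUnion₂_subset hsub
    _ ≤ C * (volume (ball x (R * l)) * maximalFunction h x) := by
        gcongr
        exact setLIntegral_ball_le_maximalFunction h x (by positivity)
    _ ≤ C * (ENNReal.ofReal (2 * R) ^ n * volume (cube b l) * maximalFunction h x) := by
        gcongr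
        exact volume_ball_le_volume_cube x b hR0
    _ = _ := by
        simp only [ENNReal.ofReal]
        push_cast
        ring

/-- Numbers below the non-tangential norm of `u` are attained, up to constants, by pairing `u` with
functions of bounded Carleson norm. -/
theorem exists_lintegral_mul_ge_of_lt_nontangential (n : ℕ) {a : ℝ} (ha : 0 < a) (hc₀ : 1 < c₀)
    (hc₁ : 0 < c₁) {p p' q q' : ℝ≥0∞} [ENNReal.HolderConjugate p p']
    [ENNReal.HolderConjugate q q'] (hp : p < ∞) :
    ∃ K : ℝ≥0, ∀ u : Space n → ℝ≥0∞, Measurable u → ∀ l : ℝ≥0∞,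
      l < eLpNorm (nontangentialMax a (whitneyMean c₀ c₁ q u)) p volume →
      ∃ v : Space n → ℝ≥0, Measurable v ∧
        eLpNorm (carlesonFunctional 1 (whitneyMean c₀ c₁ q' fun w => (v w : ℝ≥0∞))) p' volume ≤ K ∧
        l ≤ 2 * ∫⁻ w in halfSpace n, u w * v w := by
  obtain ⟨C₁, hC₁⟩ := exists_superposition n hc₀ hc₁ (q := q) (q' := q')
  obtain ⟨C₂, hC₂⟩ := exists_carlesonFunctional_le_maximalFunction n ha hc₀ hc₁
  obtain ⟨C₃, hC₃⟩ := exists_eLpNorm_maximalFunction_le n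
    ((ENNReal.HolderConjugate.lt_top_iff_one_lt p p').1 hp)
  refine ⟨C₂ * (C₃ * C₁), fun u hu l hl => ?_⟩
  set F := whitneyMean c₀ c₁ q u with hF
  have hFl : LowerSemicontinuous F :=
    lowerSemicontinuous_whitneyMean hc₀ hc₁ (ENNReal.HolderConjugate.ne_zero q q') hu
  obtain ⟨h, hh, hh1, hhi, hlh⟩ := exists_lt_lintegral_mul (q := p')
    (measurable_nontangentialMax a ha hFl) hl
  obtain ⟨d, hd0, hd⟩ := exists_dense_seq_halfSpace n
  -- finite approximations of the maximal function from below
  let φ : ℕ → ℕ → EuclideanSpace ℝ (Fin n) → ℝ≥0∞ := fun m k =>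
    (closedBall (d k).2 (a * (d k).1)).indicator fun _ => min (F (d k)) m
  have hφ : ∀ m k, Measurable (φ m k) := fun m k =>
    measurable_const.indicator measurableSet_closedBall
  let N : ℕ → EuclideanSpace ℝ (Fin n) → ℝ≥0∞ := fun m y => (Finset.range m).sup fun k => φ m k y
  have hNm : ∀ m, Measurable (N m) := fun m => measurable_range_sup (hφ m) m
  have hNmono : Monotone N := by
    intro i j hij y
    refine Finset.sup_le fun k hk => ?_
    refine le_trans ?_ (Finset.le_sup (f := fun k => φ j k y)
      (Finset.range_subset_range.2 hij hk))
    refine indicator_le_indicator ?_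
    gcongr
  have hNsup : ∀ y, nontangentialMax a F y ≤ ⨆ m, N m y := by
    intro y
    refine le_of_forall_lt fun c hc => ?_
    simp only [nontangentialMax, lt_iSup_iff] at hc
    obtain ⟨z, ⟨hz, hzy⟩, hcz⟩ := hc
    -- an open set of points in the cone at `y` on which `F` exceeds `c`
    obtain ⟨t, hct, ht⟩ : ∃ t, c < F (t, z.2) ∧ z.1 < t := by
      have hcont : ContinuousAt (fun t : ℝ => ((t, z.2) : Space n)) z.1 := by fun_prop
      have hev : ∀ᶠ t in 𝓝[>] z.1, c < F (t, z.2) :=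
        (hcont.eventually (hFl z c hcz)).filter_mono nhdsWithin_le_nhds
      obtain ⟨t, ht1, ht2⟩ := (hev.and self_mem_nhdsWithin).exists
      exact ⟨t, ht1, ht2⟩
    have hopen : IsOpen {x : Space n | c < F x ∧ ‖x.2 - y‖ < a * x.1} :=
      IsOpen.and (hFl.isOpen_preimage c) (isOpen_lt (by fun_prop) (by fun_prop))
    obtain ⟨k, hk1, hk2⟩ := hd _ hopen ⟨(t, z.2), ⟨hct, by dsimp only; nlinarith⟩,
      lt_trans (show 0 < z.1 from hz) ht⟩
    obtain ⟨i, hi⟩ := ENNReal.exists_nat_gt hct.ne_top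
    refine lt_of_lt_of_le ?_ (le_iSup _ (max (k + 1) i))
    refine lt_of_lt_of_le ?_ (Finset.le_sup (f := fun j => φ (max (k + 1) i) j y)
      (Finset.mem_range.2 (lt_of_lt_of_le k.lt_succ_self (le_max_left _ _))))
    have hy : y ∈ closedBall (d k).2 (a * (d k).1) := by
      rw [mem_closedBall, dist_comm, dist_eq_norm]
      exact hk2.le
    simp only [φ, indicator_of_mem hy]
    refine lt_min hk1 (hi.trans_le ?_)
    exact_mod_cast le_max_right _ _
  obtain ⟨m, hm⟩ : ∃ m, l < ∫⁻ y, N m y * h y := by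
    rw [← lt_iSup_iff, ← lintegral_iSup (f := fun m y => N m y * h y) (fun m => (hNm m).mul hh.coe_nnreal_ennreal)
      (fun i j hij y => mul_le_mul_left (hNmono hij y) _)]
    refine hlh.trans_le (lintegral_mono fun y => ?_)
    rw [← ENNReal.iSup_mul]
    exact mul_le_mul_left (hNsup y) _
  obtain ⟨E, hE, hEd, hEN⟩ := exists_lintegral_sup_mul_le volume (hφ m) m
  let B : ℕ → Set (EuclideanSpace ℝ (Fin n)) := fun k => E k ∩ closedBall (d k).2 (a * (d k).1)
  have hB : ∀ k, MeasurableSet (B k) := fun k => (hE k).inter measurableSet_closedBall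
  have hBfin : ∀ k, ∫⁻ y in B k, h y ≠ ∞ := fun k =>
    ne_top_of_le_ne_top hhi (setLIntegral_le_lintegral _ _)
  obtain ⟨v, hv, huv, hvb⟩ := hC₁ (Finset.range m) d (fun k => (∫⁻ y in B k, h y).toNNReal)
    (fun k => min (F (d k)) m / 2) u hu (fun k _ => hd0 k) (fun k _ => by
      rcases eq_or_ne (min (F (d k)) m) 0 with h0 | h0
      · left; simp [h0]
      · right
        exact (ENNReal.half_lt_self h0 (ne_top_of_le_ne_top (by simp) (min_le_right _ _))).trans_le
          (min_le_left _ _))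
  refine ⟨v, hv, ?_, ?_⟩
  · have hpt : ∀ x, carlesonFunctional 1 (whitneyMean c₀ c₁ q' fun w => (v w : ℝ≥0∞)) x ≤
        C₂ * maximalFunction (fun y => (C₁ * h y : ℝ≥0∞)) x := by
      refine hC₂ (Finset.range m) d (fun k => C₁ * (∫⁻ y in B k, h y).toNNReal) B _ _
        (fun k _ => hd0 k) hB (fun i j hij => (hEd hij).mono inter_subset_left inter_subset_left)
        (fun k _ => inter_subset_right) (fun k _ => ?_) (fun w hw => ?_)
      · rw [lintegral_const_mul' _ _ ENNReal.coe_ne_top, ENNReal.coe_mul,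
          ENNReal.coe_toNNReal (hBfin k)]
      · refine (hvb w hw).trans (le_of_eq ?_)
        rw [Finset.mul_sum]
        refine Finset.sum_congr rfl fun k _ => ?_
        simp only [indicator]
        split_ifs
        · push_cast; ring
        · simp
    calc _ ≤ C₂ * eLpNorm (maximalFunction fun y => (C₁ * h y : ℝ≥0∞)) p' volume :=
          eLpNorm_le_mul_eLpNorm_of_ae_le_mul' (Eventually.of_forall fun x => by simpa using hpt x) p'
      _ ≤ C₂ * (C₃ * (C₁ * 1)) := by
          gcongr
          refine (hC₃ _ (hh.coe_nnreal_ennreal.const_mul _)).trans ?_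
          gcongr
          exact (eLpNorm_const_mul_le p' _ _).trans (by gcongr)
      _ = _ := by push_cast; ring
  · calc l ≤ ∑ k ∈ Finset.range m, ∫⁻ y in E k, φ m k y * h y := hm.le.trans (hEN _)
      _ = ∑ k ∈ Finset.range m, 2 * ((∫⁻ y in B k, h y).toNNReal * (min (F (d k)) m / 2)) := by
          refine Finset.sum_congr rfl fun k _ => ?_
          have hmin : min (F (d k)) m ≠ ∞ := ne_top_of_le_ne_top (by simp) (min_le_right _ _)
          rw [ENNReal.coe_toNNReal (hBfin k), mul_left_comm, ENNReal.mul_div_cancel two_ne_zero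
            ENNReal.ofNat_ne_top, mul_comm, ← lintegral_const_mul' _ _ hmin]
          simp only [B]
          rw [inter_comm, ← setLIntegral_indicator measurableSet_closedBall]
          refine lintegral_congr fun y => ?_
          by_cases hy : y ∈ closedBall (d k).2 (a * (d k).1)
          · simp only [φ, indicator_of_mem hy]
          · simp only [φ, indicator_of_notMem hy, zero_mul]
      _ ≤ _ := by
          rw [← Finset.mul_sum]
          gcongr

end Nontangential

/-! ### The Carleson norm as a supremum of pairings -/

section Carleson

variable {n : ℕ} {c₀ c₁ : ℝ}

/-- A weighted integral of Whitney averages of `u` is realized, up to constants, by pairing `u`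
with a function whose conjugate Whitney averages are governed by averages of the weight `H` over
larger Whitney regions. The half space is cut into disjoint cells inside Whitney regions; the mass
of a cell is its integral of `H`, placed where the Whitney average of `u` is nearly largest. -/
lemma exists_lintegral_mul_ge_weighted (n : ℕ) (hc₀ : 1 < c₀) (hc₁ : 0 < c₁) {q q' : ℝ≥0∞}
    [ENNReal.HolderConjugate q q'] :
    ∃ K : ℝ≥0, ∀ u H : Space n → ℝ≥0∞, Measurable u → Measurable H →
      (∀ z, 0 < z.1 → ∫⁻ w in whitneyRegion c₀ c₁ z, H w ≠ ∞) → ∀ l : ℝ≥0∞,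
      l < ∫⁻ z in halfSpace n, whitneyMean c₀ c₁ q u z * H z →
      ∃ v : Space n → ℝ≥0, Measurable v ∧ l ≤ 2 * ∫⁻ w in halfSpace n, u w * v w ∧
        ∀ w, 0 < w.1 → whitneyMean c₀ c₁ q' (fun w => (v w : ℝ≥0∞)) w ≤
          K * ((volume (whitneyRegion c₀ c₁ w))⁻¹ *
            ∫⁻ y in whitneyRegion (c₀ ^ 4) (c₁ * (1 + c₀) ^ 2 * c₀ ^ 2) w, H y) := by
  classical
  have hc : 0 < c₀ := by linarith
  have hc2 : 1 < c₀ ^ 2 := by nlinarith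
  have hc4 : 1 < c₀ ^ 4 := by nlinarith
  obtain ⟨C₁, hC₁⟩ := exists_superposition n hc₀ hc₁ (q := q) (q' := q')
  obtain ⟨C₂, hC₂⟩ := exists_volume_whitneyRegion_le n hc₀ hc₁ hc₀ hc₁ (sq_nonneg c₀)
  refine ⟨C₁ * C₂, fun u H hu hHm hH l hl => ?_⟩
  set G := whitneyMean c₀ c₁ q u with hG
  obtain ⟨d, hd0, hd⟩ := exists_dense_seq_halfSpace n
  let W : ℕ → Set (Space n) := fun k => whitneyRegion c₀ c₁ (d k)
  have hW : ∀ k, MeasurableSet (W k) := fun k => measurableSet_whitneyRegion hc₀ _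
  let V : ℕ → Set (Space n) := disjointed W
  have hV : ∀ k, MeasurableSet (V k) := fun k => MeasurableSet.disjointed hW k
  have hVW : ∀ k, V k ⊆ W k := disjointed_subset W
  have hVU : (⋃ k, V k) = halfSpace n := by
    rw [show (⋃ k, V k) = ⋃ k, W k from iUnion_disjointed]
    refine Subset.antisymm (iUnion_subset fun k z hz => hz.1) fun z hz => ?_
    obtain ⟨k, hk⟩ := hd _ (isOpen_setOf_mem_whitneyRegion hc₀ z)
      ⟨z, mem_whitneyRegion_self hc₀ hc₁ hz, hz⟩
    exact mem_iUnion.2 ⟨k, hk⟩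
  let m : ℕ → ℝ≥0 := fun k => (∫⁻ y in V k, H y).toNNReal
  have hm : ∀ k, (m k : ℝ≥0∞) = ∫⁻ y in V k, H y := fun k => ENNReal.coe_toNNReal
    (ne_top_of_le_ne_top (hH _ (hd0 k)) (lintegral_mono_set (hVW k)))
  let S : ℕ → ℝ≥0∞ := fun k => ⨆ z ∈ W k, G z
  obtain ⟨j, M, hjM⟩ : ∃ j M : ℕ, l < ∑ k ∈ Finset.range j, min (S k) M * m k := by
    rw [← hVU, lintegral_iUnion hV (disjoint_disjointed W), ENNReal.tsum_eq_iSup_nat,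
      lt_iSup_iff] at hl
    obtain ⟨j, hj⟩ := hl
    refine ⟨j, ?_⟩
    rw [← lt_iSup_iff, ← ENNReal.finsetSum_iSup_of_monotone
      (f := fun k (M : ℕ) => min (S k) M * m k) (fun k M M' hM => by dsimp only; gcongr)]
    refine hj.trans_le (Finset.sum_le_sum fun k _ => ?_)
    rw [← ENNReal.iSup_mul, iSup_min_natCast, hm]
    refine le_trans (setLIntegral_mono' (hV k) fun z hz => ?_) (lintegral_const_mul _ hHm).le
    exact mul_le_mul_left (le_iSup₂_of_le (f := fun z (_ : z ∈ W k) => G z) z (hVW k hz) le_rfl) _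
  have hz : ∀ k, ∃ z ∈ W k, min (S k) M / 2 = 0 ∨ min (S k) M / 2 < G z := by
    intro k
    rcases eq_or_ne (min (S k) M) 0 with h0 | h0
    · exact ⟨d k, mem_whitneyRegion_self hc₀ hc₁ (hd0 k), Or.inl (by simp [h0])⟩
    · have hlt : min (S k) M / 2 < S k :=
        (ENNReal.half_lt_self h0 (ne_top_of_le_ne_top (by simp) (min_le_right _ _))).trans_le
          (min_le_left _ _)
      simp only [S, lt_iSup_iff] at hlt
      obtain ⟨z, hz, hlt⟩ := hlt
      exact ⟨z, hz, Or.inr hlt⟩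
  choose z hzW hzl using hz
  have hz0 : ∀ k, 0 < (z k).1 := fun k => (hzW k).1
  obtain ⟨v, hv, huv, hvb⟩ := hC₁ (Finset.range j) z m (fun k => min (S k) M / 2) u hu
    (fun k _ => hz0 k) (fun k _ => hzl k)
  refine ⟨v, hv, ?_, fun w hw => (hvb w hw).trans ?_⟩
  · calc l ≤ ∑ k ∈ Finset.range j, 2 * (m k * (min (S k) M / 2)) := by
          refine hjM.le.trans (le_of_eq (Finset.sum_congr rfl fun k _ => ?_))
          rw [mul_left_comm, ENNReal.mul_div_cancel two_ne_zero ENNReal.ofNat_ne_top, mul_comm]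
      _ ≤ _ := by
          rw [← Finset.mul_sum]
          gcongr
  · let D : Set (Space n) := whitneyRegion (c₀ ^ 4) (c₁ * (1 + c₀) ^ 2 * c₀ ^ 2) w
    have hw0 := volume_whitneyRegion_ne_zero hc₀ hc₁ hw
    have hwt := volume_whitneyRegion_ne_top hc₀ hc₁ w
    have hterm : ∀ k, (whitneyRegion (c₀ ^ 2) (c₁ * (1 + c₀ ^ 2)) (z k)).indicator
        (fun _ => m k * (volume (whitneyRegion c₀ c₁ (z k)))⁻¹) w ≤
        C₂ * (volume (whitneyRegion c₀ c₁ w))⁻¹ * ∫⁻ y in V k ∩ D, H y := by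
      intro k
      by_cases hwk : w ∈ whitneyRegion (c₀ ^ 2) (c₁ * (1 + c₀ ^ 2)) (z k)
      · rw [indicator_of_mem hwk, hm]
        rw [mem_whitneyRegion_iff hc2] at hwk
        obtain ⟨-, -, k3, k4, k5⟩ := hwk
        have hVD : V k ⊆ D := by
          intro y hy
          have hy := hVW k hy
          have hzk := hzW k
          simp only [W, mem_whitneyRegion_iff hc₀] at hy hzk
          rw [mem_whitneyRegion_iff hc4]
          obtain ⟨y1, y2, y3, y4, y5⟩ := hy
          obtain ⟨z1, -, z3, z4, z5⟩ := hzk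
          have e1 : (d k).1 < c₀ ^ 3 * w.1 := by
            calc (d k).1 < c₀ * (z k).1 := z4
              _ < c₀ * (c₀ ^ 2 * w.1) := by gcongr
              _ = _ := by ring
          have e2 : w.1 < c₀ ^ 3 * (d k).1 := by
            calc w.1 < c₀ ^ 2 * (z k).1 := k5
              _ < c₀ ^ 2 * (c₀ * (d k).1) := by gcongr
              _ = _ := by ring
          refine ⟨y1, hw, ?_, ?_, ?_⟩
          · have t1 := norm_sub_le_norm_sub_add_norm_sub y.2 (d k).2 w.2
            have t2 := norm_sub_le_norm_sub_add_norm_sub (d k).2 (z k).2 w.2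
            rw [norm_sub_rev (d k).2 (z k).2] at t2
            rw [norm_sub_rev] at k3
            have f1 : c₁ * (d k).1 < c₁ * (c₀ * (z k).1) := by gcongr
            have f2 : c₁ * (1 + c₀) ^ 2 * (z k).1 < c₁ * (1 + c₀) ^ 2 * (c₀ ^ 2 * w.1) := by gcongr
            linarith
          · calc w.1 < c₀ ^ 3 * (d k).1 := e2
              _ < c₀ ^ 3 * (c₀ * y.1) := by gcongr
              _ = _ := by ring
          · calc y.1 < c₀ * (d k).1 := y5
              _ < c₀ * (c₀ ^ 3 * w.1) := by gcongr
              _ = _ := by ring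
        rw [inter_eq_left.2 hVD, mul_comm]
        gcongr
        have hzk0 := volume_whitneyRegion_ne_zero hc₀ hc₁ (hz0 k)
        have hzkt := volume_whitneyRegion_ne_top hc₀ hc₁ (z k)
        rw [← div_eq_mul_inv, ENNReal.le_div_iff_mul_le (Or.inl hw0) (Or.inl hwt), mul_comm,
          ← div_eq_mul_inv]
        exact ENNReal.div_le_of_le_mul (hC₂ _ _ k5.le)
      · rw [indicator_of_notMem hwk]
        exact zero_le
    calc _ ≤ C₁ * ∑ k ∈ Finset.range j,
          C₂ * (volume (whitneyRegion c₀ c₁ w))⁻¹ * ∫⁻ y in V k ∩ D, H y := by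
          gcongr with k _
          exact hterm k
      _ = C₁ * (C₂ * (volume (whitneyRegion c₀ c₁ w))⁻¹ *
          ∫⁻ y in ⋃ k ∈ Finset.range j, V k ∩ D, H y) := by
          rw [← Finset.mul_sum, lintegral_biUnion_finset
            (fun i _ k _ hik => (disjoint_disjointed W hik).mono inter_subset_left inter_subset_left)
            fun k _ => (hV k).inter (measurableSet_whitneyRegion hc4 w)]
      _ ≤ C₁ * (C₂ * (volume (whitneyRegion c₀ c₁ w))⁻¹ * ∫⁻ y in D, H y) := by
          gcongr
          exact iUnion₂_subset fun k _ => inter_subset_right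
      _ = _ := by push_cast; ring

/-- The case of a single Carleson box: the integral of the Whitney averages of `u` over the box is
realized by pairing `u` with a function whose non-tangential maximal function is integrable. -/
lemma exists_lintegral_mul_ge_box (n : ℕ) {a : ℝ} (ha : 0 < a) (hc₀ : 1 < c₀) (hc₁ : 0 < c₁)
    {q q' : ℝ≥0∞} [ENNReal.HolderConjugate q q'] :
    ∃ K : ℝ≥0, ∀ u : Space n → ℝ≥0∞, Measurable u → ∀ (b : EuclideanSpace ℝ (Fin n)) (s : ℝ),
      0 < s → ∀ l : ℝ≥0∞, l < ∫⁻ z in carlesonBox b s, whitneyMean c₀ c₁ q u z →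
      ∃ v : Space n → ℝ≥0, Measurable v ∧ l ≤ 2 * ∫⁻ w in halfSpace n, u w * v w ∧
        ∫⁻ y, nontangentialMax a (whitneyMean c₀ c₁ q' fun w => (v w : ℝ≥0∞)) y ≤
          K * volume (cube b s) := by
  have hc : 0 < c₀ := by linarith
  have hd₀ : 1 < c₀ ^ 4 := by
    have : 1 < c₀ ^ 2 := by nlinarith
    nlinarith
  obtain ⟨C₁, hC₁⟩ := exists_lintegral_mul_ge_weighted n hc₀ hc₁ (q := q) (q' := q')
  set d₁ : ℝ := c₁ * (1 + c₀) ^ 2 * c₀ ^ 2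
  have hd₁ : 0 < d₁ := by positivity
  obtain ⟨C₂, hC₂⟩ := exists_volume_whitneyRegion_le n hd₀ hd₁ hc₀ hc₁ zero_le_one
  set R : ℝ := (a + d₁) * c₀ ^ 4 + n + 1 with hR
  have hR0 : 0 < R := by positivity
  refine ⟨C₁ * C₂ * (2 * R).toNNReal ^ n, fun u hu b s hs l hl => ?_⟩
  have hbox := measurableSet_carlesonBox b s
  obtain ⟨v, hv, huv, hvb⟩ := hC₁ u ((carlesonBox b s).indicator 1) hu
    (measurable_one.indicator hbox) (fun z _ => by
      rw [setLIntegral_indicator hbox]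
      simpa using measure_ne_top_of_subset inter_subset_right
        (volume_whitneyRegion_ne_top hc₀ hc₁ z)) l (by
      refine hl.trans_le ?_
      calc ∫⁻ z in carlesonBox b s, whitneyMean c₀ c₁ q u z
          = ∫⁻ z in carlesonBox b s, whitneyMean c₀ c₁ q u z *
            (carlesonBox b s).indicator 1 z := by
            refine setLIntegral_congr_fun hbox fun z hz => ?_
            simp [hz]
        _ ≤ _ := lintegral_mono_set fun z hz => hz.1.1)
  refine ⟨v, hv, huv, ?_⟩
  set x := cubeCorner b (-(s / 2)) with hx
  have hxb : x ∈ cube b s := mem_cube_center b hs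
  have hpt : ∀ y, nontangentialMax a (whitneyMean c₀ c₁ q' fun w => (v w : ℝ≥0∞)) y ≤
      (ball x (R * s)).indicator (fun _ => (C₁ * C₂ : ℝ≥0∞)) y := by
    intro y
    refine iSup₂_le fun w hw => ?_
    have hw0 : 0 < w.1 := hw.1
    refine (hvb w hw0).trans ?_
    rw [lintegral_indicator_one hbox, Measure.restrict_apply hbox]
    by_cases hne : (carlesonBox b s ∩ whitneyRegion (c₀ ^ 4) d₁ w).Nonempty
    · have hy : y ∈ ball x (R * s) := by
        obtain ⟨z, hzb, hzw⟩ := hne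
        rw [mem_whitneyRegion_iff hd₀] at hzw
        obtain ⟨-, -, h3, h4, -⟩ := hzw
        have hzs : z.1 < s := hzb.1.2
        have e0 : w.1 < c₀ ^ 4 * s := h4.trans (by gcongr)
        have e1 := dist_le_of_mem_cube hzb.2 hxb
        have e2 := dist_triangle y w.2 x
        have e3 := dist_triangle w.2 z.2 x
        rw [← dist_eq_norm, dist_comm] at h3
        have e4 := hw.2
        rw [← dist_eq_norm, dist_comm] at e4
        have e5 : (a + d₁) * w.1 ≤ (a + d₁) * (c₀ ^ 4 * s) := by gcongr
        rw [mem_ball, hR]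
        nlinarith
      rw [indicator_of_mem hy]
      gcongr
      rw [ENNReal.inv_mul_le_iff (volume_whitneyRegion_ne_zero hc₀ hc₁ hw0)
        (volume_whitneyRegion_ne_top hc₀ hc₁ w), mul_comm (volume _)]
      exact (measure_mono inter_subset_right).trans (hC₂ _ _ (by simp))
    · rw [not_nonempty_iff_eq_empty.1 hne, measure_empty, mul_zero, mul_zero]
      exact zero_le
  calc _ ≤ ∫⁻ y, (ball x (R * s)).indicator (fun _ => (C₁ * C₂ : ℝ≥0∞)) y := lintegral_mono hpt
    _ = C₁ * C₂ * volume (ball x (R * s)) := lintegral_indicator_const measurableSet_ball _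
    _ ≤ C₁ * C₂ * (ENNReal.ofReal (2 * R) ^ n * volume (cube b s)) := by
        gcongr
        exact volume_ball_le_volume_cube x b hR0
    _ = _ := by
        simp only [ENNReal.ofReal]
        push_cast
        ring

/-- The integral of `G` over the cone with vertex `x`, normalized by the volume of balls. -/
noncomputable def areaFunctional (G : Space n → ℝ≥0∞) (x : EuclideanSpace ℝ (Fin n)) : ℝ≥0∞ :=
  ∫⁻ z in halfSpace n, {z : Space n | x ∈ ball z.2 z.1}.indicator
    (fun z => (volume (ball z.2 z.1))⁻¹ * G z) z

lemma measurable_volume_ball_fst :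
    Measurable fun z : Space n => volume (ball z.2 z.1) := by
  have : ∀ z : Space n, volume (ball z.2 z.1) = (halfSpace n).indicator
      (fun z => ENNReal.ofReal z.1 ^ n * volume (ball (0 : EuclideanSpace ℝ (Fin n)) 1)) z := by
    intro z
    by_cases hz : 0 < z.1
    · rw [indicator_of_mem (show z ∈ halfSpace n from hz), ← volume_ball_mul z.2 _ hz, mul_one]
    · rw [indicator_of_notMem (show z ∉ halfSpace n from hz), ball_eq_empty.2 (not_lt.1 hz),
        measure_empty]
  simp_rw [this]
  exact ((measurable_fst.ennreal_ofReal.pow_const n).mul_const _).indicator measurableSet_halfSpace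

lemma measurable_areaFunctional_integrand {G : Space n → ℝ≥0∞} (hG : Measurable G) :
    Measurable fun x : EuclideanSpace ℝ (Fin n) × Space n =>
      {z : Space n | x.1 ∈ ball z.2 z.1}.indicator
        (fun z => (volume (ball z.2 z.1))⁻¹ * G z) x.2 := by
  have hS : MeasurableSet {x : EuclideanSpace ℝ (Fin n) × Space n | x.1 ∈ ball x.2.2 x.2.1} := by
    simp_rw [mem_ball]
    refine IsOpen.measurableSet (isOpen_lt ?_ ?_) <;> fun_prop
  exact ((measurable_volume_ball_fst.inv.mul hG).comp measurable_snd).indicator hS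

lemma measurable_ballAverage {h : EuclideanSpace ℝ (Fin n) → ℝ≥0∞} (hh : Measurable h) :
    Measurable fun z : Space n => (volume (ball z.2 z.1))⁻¹ * ∫⁻ y in ball z.2 z.1, h y := by
  have hm := (measurable_areaFunctional_integrand (n := n) (measurable_const (a := 1))).mul
    (hh.comp measurable_fst)
  convert hm.lintegral_prod_left' (μ := volume) using 2 with z
  rw [← lintegral_indicator measurableSet_ball,
    ← lintegral_const_mul _ (hh.indicator measurableSet_ball)]
  refine lintegral_congr fun x => ?_
  by_cases hx : x ∈ ball z.2 z.1
  · simp only [Pi.mul_apply, Function.comp_apply]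
    rw [indicator_of_mem hx, indicator_of_mem (by exact hx), mul_one]
  · simp only [Pi.mul_apply, Function.comp_apply]
    rw [indicator_of_notMem hx, indicator_of_notMem (by exact hx), zero_mul, mul_zero]

lemma measurable_areaFunctional {G : Space n → ℝ≥0∞} (hG : Measurable G) :
    Measurable (areaFunctional G) :=
  (measurable_areaFunctional_integrand hG).lintegral_prod_right'

/-- The adjoint of the area functional averages over balls. -/
lemma lintegral_areaFunctional_mul {G : Space n → ℝ≥0∞} (hG : Measurable G)
    {h : EuclideanSpace ℝ (Fin n) → ℝ≥0∞} (hh : Measurable h) :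
    ∫⁻ x, areaFunctional G x * h x =
      ∫⁻ z in halfSpace n, G z * ((volume (ball z.2 z.1))⁻¹ * ∫⁻ y in ball z.2 z.1, h y) := by
  have hm := measurable_areaFunctional_integrand hG
  calc ∫⁻ x, areaFunctional G x * h x
      = ∫⁻ x, ∫⁻ z in halfSpace n, {z : Space n | x ∈ ball z.2 z.1}.indicator
        (fun z => (volume (ball z.2 z.1))⁻¹ * G z) z * h x := by
        refine lintegral_congr fun x => ?_
        exact (lintegral_mul_const _ (hm.comp measurable_prodMk_left)).symm
    _ = ∫⁻ z in halfSpace n, ∫⁻ x, {z : Space n | x ∈ ball z.2 z.1}.indicator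
        (fun z => (volume (ball z.2 z.1))⁻¹ * G z) z * h x :=
        lintegral_lintegral_swap (hm.mul (hh.comp measurable_fst)).aemeasurable
    _ = _ := by
        refine lintegral_congr fun z => ?_
        rw [← lintegral_indicator measurableSet_ball, ← mul_assoc,
          ← lintegral_const_mul _ (hh.indicator measurableSet_ball)]
        refine lintegral_congr fun x => ?_
        by_cases hx : x ∈ ball z.2 z.1
        · rw [indicator_of_mem (by exact hx), indicator_of_mem hx, mul_comm (G z)]
        · rw [indicator_of_notMem (by exact hx), indicator_of_notMem hx, zero_mul, mul_zero]

/-- The Carleson functional is dominated by the maximal function of the area functional. -/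
lemma carlesonFunctional_le_maximalFunction_areaFunctional {G : Space n → ℝ≥0∞} (hG : Measurable G)
    (x : EuclideanSpace ℝ (Fin n)) :
    carlesonFunctional 1 G x ≤
      ((2 * (n + 1)) ^ n : ℝ≥0) * maximalFunction (areaFunctional G) x := by
  refine carlesonFunctional_one_le fun b l hl hx => ?_
  have hR : (0 : ℝ) < n + 1 := by positivity
  set B := ball x ((n + 1) * l) with hB
  calc ∫⁻ z in carlesonBox b l, G z
      ≤ ∫⁻ z in carlesonBox b l, G z * ((volume (ball z.2 z.1))⁻¹ *
        ∫⁻ y in ball z.2 z.1, B.indicator 1 y) := by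
        refine setLIntegral_mono' (measurableSet_carlesonBox b l) fun z hz => ?_
        have hsub : ball z.2 z.1 ⊆ B := by
          intro y hy
          have e1 := dist_le_of_mem_cube hz.2 hx
          have e2 := dist_triangle y z.2 x
          have e3 : z.1 < l := hz.1.2
          rw [mem_ball] at hy
          rw [hB, mem_ball]
          linarith
        rw [lintegral_indicator_one measurableSet_ball, Measure.restrict_apply measurableSet_ball,
          inter_eq_right.2 hsub, ENNReal.inv_mul_cancel (volume_ball_ne_zero _ hz.1.1)
          (volume_ball_ne_top _ _), mul_one]
    _ ≤ ∫⁻ z in halfSpace n, G z * ((volume (ball z.2 z.1))⁻¹ *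
        ∫⁻ y in ball z.2 z.1, B.indicator 1 y) := lintegral_mono_set fun z hz => hz.1.1
    _ = ∫⁻ y in B, areaFunctional G y := by
        rw [← lintegral_areaFunctional_mul hG (measurable_one.indicator measurableSet_ball),
          ← lintegral_indicator measurableSet_ball]
        refine lintegral_congr fun y => ?_
        by_cases hy : y ∈ B
        · rw [indicator_of_mem hy, indicator_of_mem hy, Pi.one_apply, mul_one]
        · rw [indicator_of_notMem hy, indicator_of_notMem hy, mul_zero]
    _ ≤ volume B * maximalFunction (areaFunctional G) x :=
        setLIntegral_ball_le_maximalFunction _ x (by positivity)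
    _ ≤ ENNReal.ofReal (2 * (n + 1)) ^ n * volume (cube b l) *
        maximalFunction (areaFunctional G) x := by
        gcongr
        exact volume_ball_le_volume_cube x b hR
    _ = _ := by
        have : ENNReal.ofReal (2 * (n + 1)) = (2 * (n + 1) : ℝ≥0) := by
          rw [← ENNReal.ofReal_coe_nnreal]; norm_num
        rw [this]
        push_cast
        ring

/-- The non-tangential maximal function of Whitney averages of ball averages of `h` is controlled
by the maximal function of `h`. -/
lemma exists_average_ballAverage_le (n : ℕ) (a : ℝ) (ha : 0 < a) (hc₀ : 1 < c₀) (hc₁ : 0 < c₁)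
    {d₀ d₁ : ℝ} (hd₀ : 1 < d₀) (hd₁ : 0 < d₁) :
    ∃ K : ℝ≥0, ∀ (h : EuclideanSpace ℝ (Fin n) → ℝ≥0∞) (w : Space n)
      (y : EuclideanSpace ℝ (Fin n)), 0 < w.1 → ‖w.2 - y‖ ≤ a * w.1 →
      (volume (whitneyRegion c₀ c₁ w))⁻¹ * ∫⁻ z in whitneyRegion d₀ d₁ w,
        ((volume (ball z.2 z.1))⁻¹ * ∫⁻ x in ball z.2 z.1, h x) ≤ K * maximalFunction h y := by
  obtain ⟨C, hC⟩ := exists_volume_whitneyRegion_le n hd₀ hd₁ hc₀ hc₁ zero_le_one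
  set R : ℝ := d₀ + d₁ + a with hR
  have hR0 : 0 < R := by positivity
  have hd : 0 < d₀ := by linarith
  refine ⟨C * (R * d₀).toNNReal ^ n, fun h w y hw hwy => ?_⟩
  have hpt : ∀ z ∈ whitneyRegion d₀ d₁ w, (volume (ball z.2 z.1))⁻¹ * ∫⁻ x in ball z.2 z.1, h x ≤
      ENNReal.ofReal (R * d₀) ^ n * maximalFunction h y := by
    intro z hz
    rw [mem_whitneyRegion_iff hd₀] at hz
    obtain ⟨h1, -, h3, h4, h5⟩ := hz
    have hsub : ball z.2 z.1 ⊆ ball y (R * d₀ * z.1) := by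
      intro x hx
      rw [mem_ball] at hx ⊢
      rw [← dist_eq_norm] at h3 hwy
      have e1 := dist_triangle x z.2 y
      have e2 := dist_triangle z.2 w.2 y
      have e3 : R * w.1 < R * (d₀ * z.1) := by gcongr
      rw [hR] at e3 ⊢
      linarith
    rw [ENNReal.inv_mul_le_iff (volume_ball_ne_zero _ h1) (volume_ball_ne_top _ _)]
    calc ∫⁻ x in ball z.2 z.1, h x ≤ ∫⁻ x in ball y (R * d₀ * z.1), h x := lintegral_mono_set hsub
      _ ≤ volume (ball y (R * d₀ * z.1)) * maximalFunction h y :=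
          setLIntegral_ball_le_maximalFunction h y (by positivity)
      _ = _ := by
          rw [volume_ball_mul y z.2 (by positivity)]
          ring
  have hw0 := volume_whitneyRegion_ne_zero hc₀ hc₁ hw
  have hwt := volume_whitneyRegion_ne_top hc₀ hc₁ w
  rw [ENNReal.inv_mul_le_iff hw0 hwt]
  calc _ ≤ ∫⁻ z in whitneyRegion d₀ d₁ w, ENNReal.ofReal (R * d₀) ^ n * maximalFunction h y :=
        setLIntegral_mono' (measurableSet_whitneyRegion hd₀ w) hpt
    _ = ENNReal.ofReal (R * d₀) ^ n * maximalFunction h y * volume (whitneyRegion d₀ d₁ w) :=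
        setLIntegral_const _ _
    _ ≤ ENNReal.ofReal (R * d₀) ^ n * maximalFunction h y *
        (C * volume (whitneyRegion c₀ c₁ w)) := by
        gcongr
        exact hC _ _ (by simp)
    _ = _ := by
        simp only [ENNReal.ofReal]
        push_cast
        ring

/-- Numbers below the Carleson norm of `u` are attained, up to constants, by pairing `u` with
functions of bounded non-tangential norm. -/
theorem exists_lintegral_mul_ge_of_lt_carleson (n : ℕ) {a : ℝ} (ha : 0 < a) (hc₀ : 1 < c₀)
    (hc₁ : 0 < c₁) {p p' q q' : ℝ≥0∞} [ENNReal.HolderConjugate p p']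
    [ENNReal.HolderConjugate q q'] (hp : p < ∞) :
    ∃ K L : ℝ≥0, ∀ u : Space n → ℝ≥0∞, Measurable u → ∀ l : ℝ≥0∞,
      l < eLpNorm (carlesonFunctional 1 (whitneyMean c₀ c₁ q' u)) p' volume →
      ∃ v : Space n → ℝ≥0, Measurable v ∧
        eLpNorm (nontangentialMax a (whitneyMean c₀ c₁ q fun w => (v w : ℝ≥0∞))) p volume ≤ K ∧
        l ≤ L * ∫⁻ w in halfSpace n, u w * v w := by
  by_cases hp' : p' = ∞
  · have hp1 := (ENNReal.HolderConjugate.eq_top_iff_eq_one p' p).1 hp'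
    obtain ⟨K, hK⟩ := exists_lintegral_mul_ge_box n ha hc₀ hc₁ (q := q') (q' := q)
    refine ⟨K, 2, fun u hu l hl => ?_⟩
    obtain ⟨x, hx⟩ : ∃ x, l < carlesonFunctional 1 (whitneyMean c₀ c₁ q' u) x := by
      by_contra! hcon
      refine hl.not_ge ?_
      rw [hp', eLpNorm_exponent_top]
      exact eLpNormEssSup_le_of_ae_enorm_bound (Eventually.of_forall fun x => hcon x)
    simp only [carlesonFunctional, lt_iSup_iff] at hx
    obtain ⟨b, s, ⟨hs, -⟩, hlt⟩ := hx
    simp only [boxMean, ENNReal.rpow_one, one_div, inv_one] at hlt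
    have h0 := volume_cube_ne_zero b hs
    have ht := volume_cube_ne_top b s
    rw [mul_comm, ← div_eq_mul_inv, ENNReal.lt_div_iff_mul_lt (Or.inl h0) (Or.inl ht)] at hlt
    obtain ⟨v, hv, huv, hvN⟩ := hK u hu b s hs _ hlt
    -- normalize by the volume of the cube
    set e : ℝ≥0 := (volume (cube b s)).toNNReal⁻¹ with he
    have hee : (e : ℝ≥0∞) = (volume (cube b s))⁻¹ := by
      rw [he, ENNReal.coe_inv (by simp [ENNReal.toNNReal_eq_zero_iff, h0, ht]),
        ENNReal.coe_toNNReal ht]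
    refine ⟨fun w => e * v w, hv.const_mul e, ?_, ?_⟩
    · rw [hp1, eLpNorm_one_eq_lintegral_enorm]
      simp only [enorm_eq_self]
      calc _ ≤ ∫⁻ y, e * nontangentialMax a (whitneyMean c₀ c₁ q fun w => (v w : ℝ≥0∞)) y := by
            refine lintegral_mono fun y => iSup₂_le fun w hw => ?_
            calc whitneyMean c₀ c₁ q (fun w => ((e * v w : ℝ≥0) : ℝ≥0∞)) w
                ≤ e * whitneyMean c₀ c₁ q (fun w => (v w : ℝ≥0∞)) w := by
                  unfold whitneyMean
                  rw [mul_left_comm]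
                  gcongr
                  simp_rw [ENNReal.coe_mul]
                  exact eLpNorm_const_mul_le q e _
              _ ≤ _ := by
                  gcongr
                  exact le_nontangentialMax _ hw.1 hw.2
        _ ≤ e * (K * volume (cube b s)) := by
            rw [lintegral_const_mul' _ _ ENNReal.coe_ne_top]
            gcongr
        _ = K := by
            rw [hee, mul_left_comm, ENNReal.inv_mul_cancel h0 ht, mul_one]
    · calc l = e * (l * volume (cube b s)) := by
            rw [hee, mul_left_comm, ENNReal.inv_mul_cancel h0 ht, mul_one]
        _ ≤ e * (2 * ∫⁻ w in halfSpace n, u w * v w) := by gcongr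
        _ = _ := by
            simp_rw [ENNReal.coe_mul, mul_left_comm (u _)]
            rw [lintegral_const_mul' _ _ ENNReal.coe_ne_top, mul_left_comm]
            rfl
  have hc : 0 < c₀ := by linarith
  have hd₀ : 1 < c₀ ^ 4 := by
    have : 1 < c₀ ^ 2 := by nlinarith
    nlinarith
  have hd₁ : 0 < c₁ * (1 + c₀) ^ 2 * c₀ ^ 2 := by positivity
  have hp1 : 1 < p := (ENNReal.HolderConjugate.lt_top_iff_one_lt p' p).1 (lt_top_iff_ne_top.2 hp')
  have hp1' : 1 < p' := (ENNReal.HolderConjugate.lt_top_iff_one_lt p p').1 hp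
  obtain ⟨A, hA⟩ := exists_lintegral_mul_ge_weighted n hc₀ hc₁ (q := q') (q' := q)
  obtain ⟨B, hB⟩ := exists_average_ballAverage_le n a ha hc₀ hc₁ hd₀ hd₁
  obtain ⟨M, hM⟩ := exists_eLpNorm_maximalFunction_le n hp1
  obtain ⟨M', hM'⟩ := exists_eLpNorm_maximalFunction_le n hp1'
  set D : ℝ≥0 := (2 * (n + 1)) ^ n * (M' + 1) with hD
  have hD0 : (D : ℝ≥0∞) ≠ 0 := by
    rw [ENNReal.coe_ne_zero, hD]; positivity
  refine ⟨A * B * M, D * 2, fun u hu l hl => ?_⟩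
  set G := whitneyMean c₀ c₁ q' u with hG
  have hGm : Measurable G :=
    measurable_whitneyMean hc₀ hc₁ (ENNReal.HolderConjugate.ne_zero q' q) hu
  have hArea := measurable_areaFunctional hGm
  have hl' : l / D < eLpNorm (areaFunctional G) p' volume := by
    refine ENNReal.div_lt_of_lt_mul' (hl.trans_le ?_)
    calc eLpNorm (carlesonFunctional 1 G) p' volume
        ≤ ((2 * (n + 1)) ^ n : ℝ≥0) * eLpNorm (maximalFunction (areaFunctional G)) p' volume :=
          eLpNorm_le_mul_eLpNorm_of_ae_le_mul' (Eventually.of_forall fun x => by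
            simpa using carlesonFunctional_le_maximalFunction_areaFunctional hGm x) p'
      _ ≤ ((2 * (n + 1)) ^ n : ℝ≥0) * ((M' + 1 : ℝ≥0) * eLpNorm (areaFunctional G) p' volume) := by
          gcongr
          refine (hM' _ hArea).trans ?_
          gcongr
          simp
      _ = _ := by rw [hD]; push_cast; ring
  obtain ⟨h, hh, hh1, hhi, hlh⟩ := exists_lt_lintegral_mul (q := p) hArea hl'
  rw [lintegral_areaFunctional_mul hGm hh.coe_nnreal_ennreal] at hlh
  obtain ⟨v, hv, huv, hvb⟩ := hA u _ hu (measurable_ballAverage hh.coe_nnreal_ennreal) (fun z hz => by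
    set ρ := z.1 / c₀ with hρdef
    have hρ : 0 < ρ := by positivity
    refine ne_top_of_le_ne_top (b := ∫⁻ w in whitneyRegion c₀ c₁ z,
      (volume (ball (0 : EuclideanSpace ℝ (Fin n)) ρ))⁻¹ * ∫⁻ y, (h y : ℝ≥0∞)) ?_
      (setLIntegral_mono' (measurableSet_whitneyRegion hc₀ z) fun w hw => ?_)
    · rw [setLIntegral_const]
      exact ENNReal.mul_ne_top (ENNReal.mul_ne_top
        (ENNReal.inv_ne_top.2 (volume_ball_ne_zero _ hρ)) hhi) (volume_whitneyRegion_ne_top hc₀ hc₁ z)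
    · rw [mem_whitneyRegion_iff hc₀] at hw
      have hle : ρ ≤ w.1 := by
        rw [hρdef, div_le_iff₀ hc]
        linarith [hw.2.2.2.1]
      refine mul_le_mul' (ENNReal.inv_le_inv.2 ?_) (setLIntegral_le_lintegral _ _)
      rw [← Measure.addHaar_ball_center volume w.2 ρ]
      exact measure_mono (ball_subset_ball hle)) _ hlh
  refine ⟨v, hv, ?_, ?_⟩
  · have hpt : ∀ y, nontangentialMax a (whitneyMean c₀ c₁ q fun w => (v w : ℝ≥0∞)) y ≤
        (A * B : ℝ≥0) * maximalFunction (fun y => (h y : ℝ≥0∞)) y := by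
      intro y
      refine iSup₂_le fun w hw => (hvb w hw.1).trans ?_
      rw [ENNReal.coe_mul, mul_assoc (A : ℝ≥0∞)]
      exact mul_le_mul_right (hB _ w y hw.1 hw.2) _
    calc _ ≤ (A * B : ℝ≥0) * eLpNorm (maximalFunction fun y => (h y : ℝ≥0∞)) p volume :=
          eLpNorm_le_mul_eLpNorm_of_ae_le_mul' (Eventually.of_forall fun x => by simpa using hpt x) p
      _ ≤ (A * B : ℝ≥0) * (M * 1) := by
          gcongr
          exact (hM _ hh.coe_nnreal_ennreal).trans (by gcongr)
      _ = _ := by push_cast; ring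
  · calc l = D * (l / D) := (ENNReal.mul_div_cancel hD0 ENNReal.coe_ne_top).symm
      _ ≤ D * (2 * ∫⁻ w in halfSpace n, u w * v w) := by gcongr
      _ = _ := by push_cast; ring

end Carleson

/-! ### Reduction of general exponents and scalars to nonnegative functions with `r = 1` -/

section Transfer

variable {𝕜 : Type*} [RCLike 𝕜] {n : ℕ} {c₀ c₁ : ℝ}

lemma exists_measurable_ae_eq_enorm_rpow {f : Space n → 𝕜}
    (hf : AEStronglyMeasurable f (halfMeasure n)) (s : ℝ) :
    ∃ u : Space n → ℝ≥0∞, Measurable u ∧ (fun z => ‖f z‖ₑ ^ s) =ᵐ[halfMeasure n] u :=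
  ⟨_, hf.stronglyMeasurable_mk.enorm.pow_const s, hf.ae_eq_mk.fun_comp fun x => ‖x‖ₑ ^ s⟩

lemma whitneyMean_congr {q : ℝ≥0∞} {u u' : Space n → ℝ≥0∞} (h : u =ᵐ[halfMeasure n] u') :
    whitneyMean c₀ c₁ q u = whitneyMean c₀ c₁ q u' := by
  ext z
  unfold whitneyMean
  rw [eLpNorm_congr_ae (ae_mono (Measure.restrict_mono (fun w hw => hw.1) le_rfl) h)]

lemma whitneyAverage_rpow {q r : ℝ≥0∞} (hr0 : r ≠ 0) (hrt : r ≠ ∞) (f : Space n → 𝕜)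
    (z : Space n) :
    whitneyAverage c₀ c₁ q f z ^ r.toReal =
      whitneyMean c₀ c₁ (q / r) (fun z => ‖f z‖ₑ ^ r.toReal) z := by
  have hr : 0 < r.toReal := ENNReal.toReal_pos hr0 hrt
  unfold whitneyAverage whitneyMean
  rw [eLpNorm_enorm_rpow f hr, ENNReal.ofReal_toReal hrt, ENNReal.div_mul_cancel hr0 hrt,
    ENNReal.mul_rpow_of_nonneg _ _ hr.le, ← ENNReal.rpow_mul]
  congr 2
  rw [one_div, one_div, ENNReal.inv_div (Or.inl hrt) (Or.inl hr0), ENNReal.toReal_inv,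
    ENNReal.toReal_div]
  ring

lemma iSup_rpow {ι : Sort*} {s : ℝ} (hs : 0 < s) (F : ι → ℝ≥0∞) :
    (⨆ i, F i) ^ s = ⨆ i, F i ^ s := by
  exact (ENNReal.orderIsoRpow s hs).map_iSup F

lemma nontangentialMax_rpow {s : ℝ} (hs : 0 < s) (a : ℝ) (F : Space n → ℝ≥0∞)
    (y : EuclideanSpace ℝ (Fin n)) :
    nontangentialMax a F y ^ s = nontangentialMax a (fun z => F z ^ s) y := by
  simp only [nontangentialMax, iSup_rpow hs]

lemma carlesonFunctional_rpow {s : ℝ} (hs : 0 < s) (F : Space n → ℝ≥0∞)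
    (x : EuclideanSpace ℝ (Fin n)) :
    carlesonFunctional s F x ^ s = carlesonFunctional 1 (fun z => F z ^ s) x := by
  simp only [carlesonFunctional, iSup_rpow hs, boxMean, ← ENNReal.rpow_mul, one_div,
    inv_mul_cancel₀ hs.ne', ENNReal.rpow_one, inv_one]

lemma nontangentialNorm_rpow (a : ℝ) {p q r : ℝ≥0∞} (hr0 : r ≠ 0) (hrt : r ≠ ∞)
    (f : Space n → 𝕜) :
    nontangentialNorm a c₀ c₁ p q f ^ r.toReal =
      eLpNorm (nontangentialMax a (whitneyMean c₀ c₁ (q / r) fun z => ‖f z‖ₑ ^ r.toReal))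
        (p / r) volume := by
  have hr : 0 < r.toReal := ENNReal.toReal_pos hr0 hrt
  have h := eLpNorm_enorm_rpow (μ := volume) (p := p / r)
    (nontangentialMax a (whitneyAverage c₀ c₁ q f)) hr
  rw [ENNReal.ofReal_toReal hrt, ENNReal.div_mul_cancel hr0 hrt] at h
  rw [nontangentialNorm, ← h]
  congr 1
  ext y
  simp only [enorm_eq_self, nontangentialMax_rpow hr, whitneyAverage_rpow hr0 hrt]

lemma carlesonNorm_rpow {p q r : ℝ≥0∞} (hr0 : r ≠ 0) (hrt : r ≠ ∞) (g : Space n → 𝕜) :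
    carlesonNorm c₀ c₁ r.toReal p q g ^ r.toReal =
      eLpNorm (carlesonFunctional 1 (whitneyMean c₀ c₁ (q / r) fun z => ‖g z‖ₑ ^ r.toReal))
        (p / r) volume := by
  have hr : 0 < r.toReal := ENNReal.toReal_pos hr0 hrt
  have h := eLpNorm_enorm_rpow (μ := volume) (p := p / r)
    (carlesonFunctional r.toReal (whitneyAverage c₀ c₁ q g)) hr
  rw [ENNReal.ofReal_toReal hrt, ENNReal.div_mul_cancel hr0 hrt] at h
  rw [carlesonNorm, ← h]
  congr 1
  ext y
  simp only [enorm_eq_self, carlesonFunctional_rpow hr, whitneyAverage_rpow hr0 hrt]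

lemma productNorm_rpow {r : ℝ≥0∞} (hr0 : r ≠ 0) (hrt : r ≠ ∞) (f g : Space n → 𝕜) :
    productNorm r f g ^ r.toReal =
      ∫⁻ z in halfSpace n, ‖f z‖ₑ ^ r.toReal * ‖g z‖ₑ ^ r.toReal := by
  have hr : 0 < r.toReal := ENNReal.toReal_pos hr0 hrt
  rw [productNorm, eLpNorm_eq_lintegral_rpow_enorm_toReal hr0 hrt, ← ENNReal.rpow_mul, one_div,
    inv_mul_cancel₀ hr.ne', ENNReal.rpow_one]
  simp_rw [enorm_mul, ENNReal.mul_rpow_of_nonneg _ _ hr.le]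
  rfl

lemma enorm_rpow_ofReal {s : ℝ} (hs : 0 < s) (v : ℝ≥0) :
    ‖(((v ^ (1 / s) : ℝ≥0) : ℝ) : 𝕜)‖ₑ ^ s = v := by
  rw [← ofReal_norm, RCLike.norm_ofReal, abs_of_nonneg (NNReal.coe_nonneg _),
    ENNReal.ofReal_coe_nnreal, ← ENNReal.coe_rpow_of_nonneg _ hs.le, ← NNReal.rpow_mul, one_div,
    inv_mul_cancel₀ hs.ne', NNReal.rpow_one]

lemma measurable_ofReal_rpow {v : Space n → ℝ≥0} (hv : Measurable v) (s : ℝ) :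
    AEStronglyMeasurable (fun z => (((v z ^ s : ℝ≥0) : ℝ) : 𝕜)) (halfMeasure n) :=
  (RCLike.measurable_ofReal.comp (hv.pow_const s).coe_nnreal_real).aestronglyMeasurable

lemma whitneyAverage_smul (q : ℝ≥0∞) (c : 𝕜) (f : Space n → 𝕜) (z : Space n) :
    whitneyAverage c₀ c₁ q (c • f) z = ‖c‖ₑ * whitneyAverage c₀ c₁ q f z := by
  unfold whitneyAverage
  rw [eLpNorm_const_smul, mul_left_comm]

lemma nontangentialNorm_smul_le (a : ℝ) (p q : ℝ≥0∞) (c : 𝕜) (f : Space n → 𝕜) :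
    nontangentialNorm a c₀ c₁ p q (c • f) ≤ ‖c‖ₑ * nontangentialNorm a c₀ c₁ p q f := by
  refine eLpNorm_le_mul_eLpNorm_of_ae_le_mul' (c := ‖c‖₊) (Eventually.of_forall fun y => ?_) p
  simp only [enorm_eq_self, nontangentialMax, whitneyAverage_smul, ← ENNReal.mul_iSup]
  rfl

lemma carlesonNorm_smul_le {r : ℝ} (hr : 0 < r) (p q : ℝ≥0∞) (c : 𝕜) (g : Space n → 𝕜) :
    carlesonNorm c₀ c₁ r p q (c • g) ≤ ‖c‖ₑ * carlesonNorm c₀ c₁ r p q g := by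
  refine eLpNorm_le_mul_eLpNorm_of_ae_le_mul' (c := ‖c‖₊) (Eventually.of_forall fun y => ?_) p
  have hbox : ∀ b l, boxMean r (whitneyAverage c₀ c₁ q (c • g)) b l =
      ‖c‖ₑ * boxMean r (whitneyAverage c₀ c₁ q g) b l := by
    intro b l
    simp only [boxMean, whitneyAverage_smul, ENNReal.mul_rpow_of_nonneg _ _ hr.le]
    rw [lintegral_const_mul' _ _ (ENNReal.rpow_ne_top_of_nonneg hr.le enorm_ne_top), mul_left_comm,
      ENNReal.mul_rpow_of_nonneg _ _ (by positivity), ← ENNReal.rpow_mul, one_div,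
      mul_inv_cancel₀ hr.ne', ENNReal.rpow_one]
  simp only [enorm_eq_self, carlesonFunctional, hbox, ← ENNReal.mul_iSup]
  rfl

lemma productNorm_comm (r : ℝ≥0∞) (f g : Space n → 𝕜) :
    productNorm r f g = productNorm r g f := by
  simp only [productNorm, mul_comm]

lemma productNorm_smul_left (r : ℝ≥0∞) (c : 𝕜) (f g : Space n → 𝕜) :
    productNorm r (c • f) g = ‖c‖ₑ * productNorm r f g := by
  rw [productNorm, productNorm, ← eLpNorm_const_smul]
  congr 1
  ext z
  simp [mul_assoc]

/-- Normalization: if every number below `X` is attained, up to the factor `L`, by the values of a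
homogeneous functional `Φ` on the ball of radius `K` of a homogeneous gauge `Ψ`, then `X` is at most
`L K` times the supremum of `Φ` over the unit sphere of `Ψ`. -/
lemma le_mul_iSup_unit_sphere {P : (Space n → 𝕜) → Prop} {Φ Ψ : (Space n → 𝕜) → ℝ≥0∞} {X : ℝ≥0∞}
    {K L : ℝ≥0} (hP : ∀ (c : 𝕜) g, P g → P (c • g))
    (hΦ : ∀ (c : 𝕜) g, Φ (c • g) = ‖c‖ₑ * Φ g) (hΨ : ∀ (c : 𝕜) g, Ψ (c • g) ≤ ‖c‖ₑ * Ψ g)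
    (hzero : ∀ g, P g → Ψ g = 0 → Φ g = 0)
    (h : ∀ l < X, ∃ g, P g ∧ Ψ g ≤ K ∧ l ≤ L * Φ g) :
    X ≤ (L * K : ℝ≥0) * ⨆ (g : Space n → 𝕜) (_ : P g ∧ Ψ g = 1), Φ g := by
  refine le_of_forall_lt_imp_le_of_dense fun l hl => ?_
  obtain ⟨g, hg, hgK, hlg⟩ := h l hl
  rcases eq_or_ne (Ψ g) 0 with h0 | h0
  · rw [hzero g hg h0, mul_zero] at hlg
    exact hlg.trans zero_le
  have ht : Ψ g ≠ ∞ := ne_top_of_le_ne_top ENNReal.coe_ne_top hgK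
  set e : 𝕜 := (((Ψ g).toReal⁻¹ : ℝ) : 𝕜) with he
  have hpos : 0 < (Ψ g).toReal := ENNReal.toReal_pos h0 ht
  have hee : ‖e‖ₑ = (Ψ g)⁻¹ := by
    rw [← ofReal_norm, he, RCLike.norm_ofReal, abs_of_pos (by positivity),
      ENNReal.ofReal_inv_of_pos hpos, ENNReal.ofReal_toReal ht]
  have he0 : e ≠ 0 := by
    rw [he]
    exact_mod_cast inv_ne_zero hpos.ne'
  have h1 : Ψ (e • g) = 1 := by
    refine le_antisymm ((hΨ e g).trans (by rw [hee, ENNReal.inv_mul_cancel h0 ht])) ?_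
    have := hΨ e⁻¹ (e • g)
    rw [smul_smul, inv_mul_cancel₀ he0, one_smul, enorm_inv he0, hee, inv_inv] at this
    rwa [← ENNReal.mul_le_mul_iff_right h0 ht, mul_one]
  calc l ≤ L * Φ g := hlg
    _ = L * (Ψ g * Φ (e • g)) := by
        rw [hΦ, hee, ← mul_assoc (Ψ g), ENNReal.mul_inv_cancel h0 ht, one_mul]
    _ ≤ L * (K * ⨆ (g : Space n → 𝕜) (_ : P g ∧ Ψ g = 1), Φ g) := by
        gcongr
        exact le_iSup₂_of_le (f := fun (g : Space n → 𝕜) (_ : P g ∧ Ψ g = 1) => Φ g) (e • g)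
          ⟨hP e g hg, h1⟩ le_rfl
    _ = _ := by push_cast; ring

variable {p p' q q' r : ℝ≥0∞}

lemma exists_productNorm_le (n : ℕ) {a : ℝ} (ha : 0 < a) (hc₀ : 1 < c₀) (hc₁ : 0 < c₁)
    [ENNReal.HolderTriple p p' r] [ENNReal.HolderTriple q q' r] (hr0 : r ≠ 0) (hrt : r ≠ ∞) :
    ∃ C : ℝ≥0, ∀ f g : Space n → 𝕜, AEStronglyMeasurable f (halfMeasure n) →
      AEStronglyMeasurable g (halfMeasure n) →
      productNorm r f g ≤
        C * nontangentialNorm a c₀ c₁ p q f * carlesonNorm c₀ c₁ r.toReal p' q' g := by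
  have hp := ENNReal.HolderTriple.holderConjugate_div_div p p' r hr0 hrt
  have hq := ENNReal.HolderTriple.holderConjugate_div_div q q' r hr0 hrt
  have hr : 0 < r.toReal := ENNReal.toReal_pos hr0 hrt
  obtain ⟨K, hK⟩ := exists_lintegral_mul_le n ha hc₀ hc₁ (p := p / r) (p' := p' / r)
    (q := q / r) (q' := q' / r)
  refine ⟨K ^ (1 / r.toReal), fun f g hf hg => ?_⟩
  obtain ⟨u, hu, hfu⟩ := exists_measurable_ae_eq_enorm_rpow hf r.toReal
  obtain ⟨v, hv, hgv⟩ := exists_measurable_ae_eq_enorm_rpow hg r.toReal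
  rw [← ENNReal.rpow_le_rpow_iff hr, ENNReal.mul_rpow_of_nonneg _ _ hr.le,
    ENNReal.mul_rpow_of_nonneg _ _ hr.le, productNorm_rpow hr0 hrt, nontangentialNorm_rpow a hr0 hrt,
    carlesonNorm_rpow hr0 hrt, whitneyMean_congr hfu, whitneyMean_congr hgv,
    ENNReal.coe_rpow_of_nonneg _ (by positivity), ← ENNReal.rpow_mul, one_div,
    inv_mul_cancel₀ hr.ne', ENNReal.rpow_one]
  refine le_trans (le_of_eq (lintegral_congr_ae ?_)) (hK u v hu hv)
  filter_upwards [hfu, hgv] with z h1 h2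
  rw [h1, h2]

lemma exists_nontangentialNorm_le (n : ℕ) {a : ℝ} (ha : 0 < a) (hc₀ : 1 < c₀) (hc₁ : 0 < c₁)
    [ENNReal.HolderTriple p p' r] [ENNReal.HolderTriple q q' r] (hr0 : r ≠ 0) (hrt : r ≠ ∞)
    (hp : p < ∞) :
    ∃ C : ℝ≥0, ∀ f : Space n → 𝕜, AEStronglyMeasurable f (halfMeasure n) →
      nontangentialNorm a c₀ c₁ p q f ≤ C * ⨆ (g : Space n → 𝕜)
        (_ : AEStronglyMeasurable g (halfMeasure n) ∧ carlesonNorm c₀ c₁ r.toReal p' q' g = 1),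
        productNorm r f g := by
  have hpp := ENNReal.HolderTriple.holderConjugate_div_div p p' r hr0 hrt
  have hqq := ENNReal.HolderTriple.holderConjugate_div_div q q' r hr0 hrt
  have hr : 0 < r.toReal := ENNReal.toReal_pos hr0 hrt
  have hri : 0 < 1 / r.toReal := by positivity
  obtain ⟨C, hC⟩ := exists_productNorm_le (𝕜 := 𝕜) (p := p) (p' := p') (q := q) (q' := q')
    n ha hc₀ hc₁ hr0 hrt
  obtain ⟨K, hK⟩ := exists_lintegral_mul_ge_of_lt_nontangential n ha hc₀ hc₁ (p := p / r)
    (p' := p' / r) (q := q / r) (q' := q' / r) (ENNReal.div_lt_top hp.ne hr0)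
  refine ⟨2 ^ (1 / r.toReal) * K ^ (1 / r.toReal), fun f hf => ?_⟩
  obtain ⟨u, hu, hfu⟩ := exists_measurable_ae_eq_enorm_rpow hf r.toReal
  refine le_mul_iSup_unit_sphere (fun c g hg => hg.const_smul c)
    (fun c g => by rw [productNorm_comm, productNorm_smul_left, productNorm_comm])
    (fun c g => carlesonNorm_smul_le hr p' q' c g)
    (fun g hg h0 => by simpa [h0] using hC f g hf hg) (fun l hl => ?_)
  rw [← ENNReal.rpow_lt_rpow_iff hr, nontangentialNorm_rpow a hr0 hrt, whitneyMean_congr hfu] at hl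
  obtain ⟨v, hv, hvK, hlv⟩ := hK u hu _ hl
  refine ⟨fun z => (((v z ^ (1 / r.toReal) : ℝ≥0) : ℝ) : 𝕜), measurable_ofReal_rpow hv _, ?_, ?_⟩
  · rw [← ENNReal.rpow_le_rpow_iff hr, carlesonNorm_rpow hr0 hrt,
      ENNReal.coe_rpow_of_nonneg _ hri.le, ← ENNReal.rpow_mul, one_div, inv_mul_cancel₀ hr.ne',
      ENNReal.rpow_one]
    simp_rw [← one_div, enorm_rpow_ofReal hr]
    exact hvK
  · rw [← ENNReal.rpow_le_rpow_iff hr, ENNReal.mul_rpow_of_nonneg _ _ hr.le,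
      productNorm_rpow hr0 hrt, ENNReal.coe_rpow_of_nonneg _ hri.le, ← ENNReal.rpow_mul, one_div,
      inv_mul_cancel₀ hr.ne', ENNReal.rpow_one]
    simp_rw [← one_div, enorm_rpow_ofReal hr]
    refine hlv.trans (le_of_eq ?_)
    congr 1
    refine lintegral_congr_ae ?_
    filter_upwards [hfu] with z hz
    rw [hz]

lemma exists_carlesonNorm_le (n : ℕ) {a : ℝ} (ha : 0 < a) (hc₀ : 1 < c₀) (hc₁ : 0 < c₁)
    [ENNReal.HolderTriple p p' r] [ENNReal.HolderTriple q q' r] (hr0 : r ≠ 0) (hrt : r ≠ ∞)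
    (hp : p < ∞) :
    ∃ C : ℝ≥0, ∀ g : Space n → 𝕜, AEStronglyMeasurable g (halfMeasure n) →
      carlesonNorm c₀ c₁ r.toReal p' q' g ≤ C * ⨆ (f : Space n → 𝕜)
        (_ : AEStronglyMeasurable f (halfMeasure n) ∧ nontangentialNorm a c₀ c₁ p q f = 1),
        productNorm r f g := by
  have hpp := ENNReal.HolderTriple.holderConjugate_div_div p p' r hr0 hrt
  have hqq := ENNReal.HolderTriple.holderConjugate_div_div q q' r hr0 hrt
  have hr : 0 < r.toReal := ENNReal.toReal_pos hr0 hrt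
  have hri : 0 < 1 / r.toReal := by positivity
  obtain ⟨C, hC⟩ := exists_productNorm_le (𝕜 := 𝕜) (p := p) (p' := p') (q := q) (q' := q')
    n ha hc₀ hc₁ hr0 hrt
  obtain ⟨K, L, hK⟩ := exists_lintegral_mul_ge_of_lt_carleson n ha hc₀ hc₁ (p := p / r)
    (p' := p' / r) (q := q / r) (q' := q' / r) (ENNReal.div_lt_top hp.ne hr0)
  refine ⟨L ^ (1 / r.toReal) * K ^ (1 / r.toReal), fun g hg => ?_⟩
  obtain ⟨u, hu, hgu⟩ := exists_measurable_ae_eq_enorm_rpow hg r.toReal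
  refine le_mul_iSup_unit_sphere (fun c f hf => hf.const_smul c)
    (fun c f => productNorm_smul_left r c f g)
    (fun c f => nontangentialNorm_smul_le a p q c f)
    (fun f hf h0 => by simpa [h0] using hC f g hf hg) (fun l hl => ?_)
  rw [← ENNReal.rpow_lt_rpow_iff hr, carlesonNorm_rpow hr0 hrt, whitneyMean_congr hgu] at hl
  obtain ⟨v, hv, hvK, hlv⟩ := hK u hu _ hl
  refine ⟨fun z => (((v z ^ (1 / r.toReal) : ℝ≥0) : ℝ) : 𝕜), measurable_ofReal_rpow hv _, ?_, ?_⟩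
  · rw [← ENNReal.rpow_le_rpow_iff hr, nontangentialNorm_rpow a hr0 hrt,
      ENNReal.coe_rpow_of_nonneg _ hri.le, ← ENNReal.rpow_mul, one_div, inv_mul_cancel₀ hr.ne',
      ENNReal.rpow_one]
    simp_rw [← one_div, enorm_rpow_ofReal hr]
    exact hvK
  · rw [← ENNReal.rpow_le_rpow_iff hr, ENNReal.mul_rpow_of_nonneg _ _ hr.le, productNorm_comm,
      productNorm_rpow hr0 hrt, ENNReal.coe_rpow_of_nonneg _ hri.le, ← ENNReal.rpow_mul, one_div,
      inv_mul_cancel₀ hr.ne', ENNReal.rpow_one]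
    simp_rw [← one_div, enorm_rpow_ofReal hr]
    refine hlv.trans (le_of_eq ?_)
    congr 1
    refine lintegral_congr_ae ?_
    filter_upwards [hgu] with z hz
    rw [hz]

end Transfer

/-! ### Pointwise multipliers on the Kenig--Pipher space -/

section Multipliers

variable {𝕜 : Type*} [RCLike 𝕜] {n : ℕ} {c₀ c₁ : ℝ}

/-- The essential supremum of the Carleson functional is a supremum over all cubes, since cubes have
positive measure. -/
lemma carlesonNorm_top_eq_dahlbergNorm (g : Space n → 𝕜) :
    carlesonNorm c₀ c₁ 2 ∞ ∞ g = dahlbergNorm c₀ c₁ g := by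
  rw [carlesonNorm, eLpNorm_exponent_top]
  apply le_antisymm
  · refine eLpNormEssSup_le_of_ae_enorm_bound (Eventually.of_forall fun x => ?_)
    rw [enorm_eq_self]
    refine iSup_mono fun b => iSup_mono fun l => iSup_le fun h => ?_
    exact le_iSup_of_le h.1 le_rfl
  · refine iSup_le fun b => iSup_le fun l => iSup_le fun hl => ?_
    by_contra! hlt
    have hae := enorm_ae_le_eLpNormEssSup (carlesonFunctional 2 (whitneyAverage c₀ c₁ ∞ g)) volume
    rw [ae_iff] at hae
    refine volume_cube_ne_zero b hl (measure_mono_null (fun x hx => ?_) hae)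
    rw [mem_ofPred_eq, not_le, enorm_eq_self]
    refine hlt.trans_le ?_
    exact le_iSup_of_le b (le_iSup_of_le l (le_iSup_of_le (ι := 0 < l ∧ x ∈ cube b l) ⟨hl, hx⟩ le_rfl))

lemma exists_productNorm_le_dahlbergNorm (n : ℕ) {a : ℝ} (ha : 0 < a) (hc₀ : 1 < c₀)
    (hc₁ : 0 < c₁) :
    ∃ C : ℝ≥0, ∀ f g : Space n → 𝕜, AEStronglyMeasurable f (halfMeasure n) →
      AEStronglyMeasurable g (halfMeasure n) →
      productNorm 2 f g ≤ C * dahlbergNorm c₀ c₁ g * kenigPipherNorm a c₀ c₁ f := by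
  obtain ⟨C, hC⟩ := exists_productNorm_le (𝕜 := 𝕜) (p := 2) (p' := ∞) (q := 2) (q' := ∞) (r := 2)
    n ha hc₀ hc₁ two_ne_zero ENNReal.ofNat_ne_top
  refine ⟨C, fun f g hf hg => (hC f g hf hg).trans (le_of_eq ?_)⟩
  rw [ENNReal.toReal_ofNat, carlesonNorm_top_eq_dahlbergNorm, kenigPipherNorm, mul_right_comm]

lemma exists_dahlbergNorm_le_multiplierNorm (n : ℕ) {a : ℝ} (ha : 0 < a) (hc₀ : 1 < c₀)
    (hc₁ : 0 < c₁) :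
    ∃ C : ℝ≥0, ∀ g : Space n → 𝕜, AEStronglyMeasurable g (halfMeasure n) →
      dahlbergNorm c₀ c₁ g ≤ C * multiplierNorm a c₀ c₁ g := by
  obtain ⟨C, hC⟩ := exists_carlesonNorm_le (𝕜 := 𝕜) (p := 2) (p' := ∞) (q := 2) (q' := ∞) (r := 2)
    n ha hc₀ hc₁ two_ne_zero ENNReal.ofNat_ne_top (by simp)
  refine ⟨C, fun g hg => ?_⟩
  have h := hC g hg
  rw [ENNReal.toReal_ofNat, carlesonNorm_top_eq_dahlbergNorm] at h
  refine h.trans (mul_le_mul_right (iSup₂_le fun f hf => ?_) _)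
  refine le_iSup₂_of_le (f := fun (f : Space n → 𝕜) (_ : AEStronglyMeasurable f (halfMeasure n) ∧
    kenigPipherNorm a c₀ c₁ f ≠ 0 ∧ kenigPipherNorm a c₀ c₁ f ≠ ∞) =>
      productNorm 2 f g / kenigPipherNorm a c₀ c₁ f) f ⟨hf.1, ?_, ?_⟩ ?_
  · rw [kenigPipherNorm, hf.2]; exact one_ne_zero
  · rw [kenigPipherNorm, hf.2]; exact ENNReal.one_ne_top
  · rw [kenigPipherNorm, hf.2, div_one]

end Multipliers

end CarlesonDuality

theorem theorem3p1 {𝕜 : Type*} [RCLike 𝕜] (n : ℕ) (hn : 1 ≤ n)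
    (a c₀ c₁ : ℝ) (ha : 0 < a) (hc₀ : 1 < c₀) (hc₁ : 0 < c₁) :
    (∀ p p' q q' r : ℝ≥0∞,
      1 / p + 1 / p' = 1 / r → 1 / q + 1 / q' = 1 / r →
      r ≤ p → p < ∞ → r ≤ q → 1 ≤ r → r < ∞ →
      ∃ C : ℝ≥0, 0 < C ∧
        (∀ f g : CarlesonDuality.Space n → 𝕜,
          AEStronglyMeasurable f (CarlesonDuality.halfMeasure n) →
          AEStronglyMeasurable g (CarlesonDuality.halfMeasure n) →
          CarlesonDuality.productNorm r f g ≤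
            C * CarlesonDuality.nontangentialNorm a c₀ c₁ p q f *
              CarlesonDuality.carlesonNorm c₀ c₁ r.toReal p' q' g) ∧
        (∀ f : CarlesonDuality.Space n → 𝕜,
          AEStronglyMeasurable f (CarlesonDuality.halfMeasure n) →
          CarlesonDuality.nontangentialNorm a c₀ c₁ p q f ≤
            C * ⨆ (g : CarlesonDuality.Space n → 𝕜)
              (_ : AEStronglyMeasurable g (CarlesonDuality.halfMeasure n) ∧
                CarlesonDuality.carlesonNorm c₀ c₁ r.toReal p' q' g = 1),
              CarlesonDuality.productNorm r f g) ∧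
        (∀ g : CarlesonDuality.Space n → 𝕜,
          AEStronglyMeasurable g (CarlesonDuality.halfMeasure n) →
          CarlesonDuality.carlesonNorm c₀ c₁ r.toReal p' q' g ≤
            C * ⨆ (f : CarlesonDuality.Space n → 𝕜)
              (_ : AEStronglyMeasurable f (CarlesonDuality.halfMeasure n) ∧
                CarlesonDuality.nontangentialNorm a c₀ c₁ p q f = 1),
              CarlesonDuality.productNorm r f g)) ∧
    (∃ C : ℝ≥0, 0 < C ∧
      ∀ g : CarlesonDuality.Space n → 𝕜,
        AEStronglyMeasurable g (CarlesonDuality.halfMeasure n) →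
        CarlesonDuality.multiplierNorm a c₀ c₁ g ≤ C * CarlesonDuality.dahlbergNorm c₀ c₁ g ∧
        CarlesonDuality.dahlbergNorm c₀ c₁ g ≤ C * CarlesonDuality.multiplierNorm a c₀ c₁ g) ∧
    (∀ g : CarlesonDuality.Space n → 𝕜,
      AEStronglyMeasurable g (CarlesonDuality.halfMeasure n) →
      (CarlesonDuality.IsBoundedMultiplier a c₀ c₁ g ↔
        CarlesonDuality.dahlbergNorm c₀ c₁ g < ∞)) := by
  open CarlesonDuality in
  refine ⟨fun p p' q q' r hp hq _ hpt _ hr1 hrt => ?_, ?_, fun g hg => ?_⟩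
  · have hpt3 : ENNReal.HolderTriple p p' r := ⟨by simpa using hp⟩
    have hqt3 : ENNReal.HolderTriple q q' r := ⟨by simpa using hq⟩
    have hr0 : r ≠ 0 := (zero_lt_one.trans_le hr1).ne'
    obtain ⟨C₁, h₁⟩ := exists_productNorm_le (𝕜 := 𝕜) (p := p) (p' := p') (q := q) (q' := q')
      n ha hc₀ hc₁ hr0 hrt.ne
    obtain ⟨C₂, h₂⟩ := exists_nontangentialNorm_le (𝕜 := 𝕜) (p := p) (p' := p') (q := q) (q' := q')
      n ha hc₀ hc₁ hr0 hrt.ne hpt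
    obtain ⟨C₃, h₃⟩ := exists_carlesonNorm_le (𝕜 := 𝕜) (p := p) (p' := p') (q := q) (q' := q')
      n ha hc₀ hc₁ hr0 hrt.ne hpt
    refine ⟨C₁ + C₂ + C₃ + 1, by positivity, fun f g hf hg => (h₁ f g hf hg).trans ?_,
      fun f hf => (h₂ f hf).trans ?_, fun g hg => (h₃ g hg).trans ?_⟩
    · gcongr
      exact (le_add_right le_rfl).trans ((le_add_right le_rfl).trans (le_add_right le_rfl))
    · gcongr
      exact (le_add_left le_rfl).trans ((le_add_right le_rfl).trans (le_add_right le_rfl))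
    · gcongr
      exact (le_add_left le_rfl).trans (le_add_right le_rfl)
  · obtain ⟨C₁, h₁⟩ := exists_productNorm_le_dahlbergNorm (𝕜 := 𝕜) n ha hc₀ hc₁
    obtain ⟨C₂, h₂⟩ := exists_dahlbergNorm_le_multiplierNorm (𝕜 := 𝕜) n ha hc₀ hc₁
    refine ⟨C₁ + C₂ + 1, by positivity, fun g hg => ⟨iSup₂_le fun f hf => ?_, (h₂ g hg).trans ?_⟩⟩
    · refine (ENNReal.div_le_of_le_mul (h₁ f g hf.1 hg)).trans ?_
      gcongr
      exact (le_add_right le_rfl).trans (le_add_right le_rfl)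
    · gcongr
      exact (le_add_left le_rfl).trans (le_add_right le_rfl)
  · obtain ⟨C₁, h₁⟩ := exists_productNorm_le_dahlbergNorm (𝕜 := 𝕜) n ha hc₀ hc₁
    obtain ⟨C₂, h₂⟩ := exists_dahlbergNorm_le_multiplierNorm (𝕜 := 𝕜) n ha hc₀ hc₁
    constructor
    · rintro ⟨K, hK⟩
      refine (h₂ g hg).trans_lt (ENNReal.mul_lt_top ENNReal.coe_lt_top ?_)
      refine lt_of_le_of_lt (iSup₂_le fun f hf => ?_) (ENNReal.coe_lt_top (r := K))
      exact ENNReal.div_le_of_le_mul (hK f hf.1 hf.2.2).2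
    · intro hfin
      refine ⟨C₁ * (dahlbergNorm c₀ c₁ g).toNNReal, fun f hf hft => ?_⟩
      have hle : productNorm 2 f g ≤
          ((C₁ * (dahlbergNorm c₀ c₁ g).toNNReal : ℝ≥0) : ℝ≥0∞) * kenigPipherNorm a c₀ c₁ f := by
        rw [ENNReal.coe_mul, ENNReal.coe_toNNReal hfin.ne]
        exact h₁ f g hf hg
      exact ⟨⟨hf.mul hg, hle.trans_lt (ENNReal.mul_lt_top ENNReal.coe_lt_top
        (lt_top_iff_ne_top.2 hft))⟩, hle⟩
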